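/- Let $1\le k<n$ and let $N=\mathbb Z^{k(n-k)}$ have the basis $f_{i,j}$ ($1\le i\le k$, $1\le j\le n-k$). Put $u_{1,0}=f_{1,1}$, $u_{i,j}=f_{i,j+1}-f_{i-1,j+1}$ ($2\le i\le k$, $0\le j\le n-k-1$), $v_{i,j}=f_{i,j+1}-f_{i,j}$ ($1\le i\le k$, $1\le j\le n-k-1$), $v_{k,n-k}=-f_{k,n-k}$. Let $\Delta(k,n)\subset N_{\mathbb R}$ be the convex hull of these vectors and $P(k,n)$ the complex toric variety of the fan over the proper faces of $\Delta(k,n)$. Put $E_1=\{u_{1,0}\}$, $E_i=\{u_{i,0},\dots,u_{i,n-k-1}\}$ ($2\le i\le k$), $E_{k+j}=\{v_{1,j},\dots,v_{k,j}\}$ ($1\le j\le n-k-1$), $E_n=\{v_{k,n-k}\}$. For a set $E$ of these vectors let $D(E)$ be the reduced torus invariant Weil divisor on $P(k,n)$ with components $D_e$, $e\in E$. Let $d_1,\dots,d_r\ge 1$ with $d_1+\dots+d_r=n$, let $\{1,\dots,n\}=J_1\sqcup\dots\sqcup J_r$ with $|J_i|=d_i$, and put $E_{J_i}=\bigcup_{j\in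 J_i}E_j$ and $\nabla_{J_i}=\mathrm{Conv}(\{0\}\cup E_{J_i})\subset N_{\mathbb R}$. Then: 1. $\Delta(k,n)$ is reflexive, the vectors $u_{i,j},v_{i,j}$ listed above are pairwise distinct and are exactly its vertices, and $E_{J_1},\dots,E_{J_r}$ is a nef-partition of them: the sets are disjoint, they cover the vertex set, and every $D(E_{J_i})$ is a semi-ample Cartier divisor on $P(k,n)$. Moreover, each $D(E_j)$ $(1\le j\le n)$ is an ample generator of $\mathrm{Pic}(P(k,n))$. 2. Let $H$ be a torus invariant divisor whose class is an ample generator of $\mathrm{Pic}(P(k,n))$, and let $Y\subset P(k,n)$ be the complete intersection with generic hypersurfaces of degrees $d_1,\dots,d_r$ in the projective space of the complete linear system $|H|$. Then $Y$ is the compactification in $P(k,n)$ of the complete intersection $g_1=\dots=g_r=0$ of generic Laurent polynomials $g_i$ whose Newton polytopes are the supporting polytopes of the global sections of $\mathcal O(D(E_{J_i}))$. Consequently the Batyrev–Borisov mirror $Y^*$ of $Y$ for the nef-partition of part 1 is the compactified generic complete intersection $$h_{J_1}(X)=\dots=h_{J_r}(X)=0,$$ where $h_{J_i}$ is a generic Laurent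 polynomial with Newton polytope $\nabla_{J_i}$; the compactification is taken in the toric variety $\mathbf P_\nabla$ of the normal fan of the Minkowski sum $\nabla=\nabla_{J_1}+\dots+\nabla_{J_r}$. 3. The polytope $\nabla$ is reflexive, so $\mathbf P_\nabla$ is a Gorenstein toric Fano variety whose anticanonical polytope is the sum of the Newton polytopes of the $h_{J_i}$ (the Calabi–Yau condition). Here the compactification of $g_1=\dots=g_r=0$ in a toric variety is the scheme-theoretic intersection of the closures of the hypersurfaces $g_i=0$ of the torus, and two families of closed subschemes have the same generic member if a property holds for the members over a non-empty Zariski open set of coefficients of one family exactly when it does for the other. -/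

import Mathlib

noncomputable section

/-! ### Lattice polytopes -/

/-- The real vector underlying a lattice vector. -/
def latticeVec {ι : Type*} (m : ι → ℤ) : ι → ℝ := fun i => (m i : ℝ)

/-- The lattice points of a subset of `ℝ^ι`. -/
def latticePoints {ι : Type*} (Q : Set (ι → ℝ)) : Set (ι → ℤ) := {m | latticeVec m ∈ Q}

/-- Convex hull of finitely many lattice points. -/
def IsLatticePolytope {ι : Type*} (Q : Set (ι → ℝ)) : Prop :=
  ∃ S : Finset (ι → ℤ), Q = convexHull ℝ (latticeVec '' (S : Set (ι → ℤ)))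

/-- The polar dual `{y | ⟨y, x⟩ ≥ -1 for all x ∈ P}`; the dual lattice is identified with `ℤ^ι`
by the dot product. -/
def polarDual {ι : Type*} [Fintype ι] (P : Set (ι → ℝ)) : Set (ι → ℝ) :=
  {y | ∀ x ∈ P, -1 ≤ y ⬝ᵥ x}

/-- A lattice polytope with `0` in its interior whose polar dual is again a lattice polytope. -/
def IsReflexive {ι : Type*} [Fintype ι] (P : Set (ι → ℝ)) : Prop :=
  IsLatticePolytope P ∧ (0 : ι → ℝ) ∈ interior P ∧ IsLatticePolytope (polarDual P)

/-- The Minkowski sum of a finite family of sets. -/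
def minkowskiSum {ι : Type*} {r : ℕ} (Q : Fin r → Set (ι → ℝ)) : Set (ι → ℝ) :=
  {x | ∃ y : Fin r → ι → ℝ, (∀ i, y i ∈ Q i) ∧ x = ∑ i, y i}

/-- The convex hull of the lattice vectors `e j`. -/
def hullOf {ι I : Type*} (e : I → ι → ℤ) : Set (ι → ℝ) :=
  convexHull ℝ (Set.range fun j => latticeVec (e j))

/-! ### The toric variety of the fan over the proper faces of a polytope

For a polytope `P` with `0` in its interior, the fan over the proper faces of `P` (the empty face
gives the cone `{0}`) defines a complete toric variety over `ℂ`, with torus `T = Spec ℂ[ℤ^ι]`.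
It is described by its affine toric charts `U_F = Spec ℂ[σ_F^∨ ∩ ℤ^ι]`, where `σ_F` is the cone
over the proper face `F`; all the coordinate rings lie in the coordinate ring of `T`. -/

/-- Laurent polynomials with exponents in `ℤ^ι`: the coordinate ring of the torus. -/
abbrev Laurent (ι : Type*) := AddMonoidAlgebra ℂ (ι → ℤ)

/-- The Laurent monomial with exponent `m`. -/
def character {ι : Type*} (m : ι → ℤ) : Laurent ι := AddMonoidAlgebra.single m 1

/-- `F` is a proper (possibly empty) face of `P`. -/
def IsProperFace {ι : Type*} (P F : Set (ι → ℝ)) : Prop := IsExposed ℝ P F ∧ F ≠ P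

/-- The lattice points of the cone dual to the cone over `F`. -/
def chartMonoid {ι : Type*} [Fintype ι] (F : Set (ι → ℝ)) : Set (ι → ℤ) :=
  {m | ∀ x ∈ F, 0 ≤ latticeVec m ⬝ᵥ x}

/-- The coordinate ring of the affine chart `U_F`. -/
def chartRing {ι : Type*} [Fintype ι] (F : Set (ι → ℝ)) : Subalgebra ℂ (Laurent ι) where
  carrier := {f | ∀ m ∈ f.coeff.support, m ∈ chartMonoid F}
  mul_mem' := by
    classical
    intro a b ha hb m hm x hx
    obtain ⟨p, hp, q, hq, rfl⟩ :=
      Finset.mem_add.1 (AddMonoidAlgebra.support_coeff_mul_subset a b hm)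
    have h : latticeVec (p + q) = latticeVec p + latticeVec q := by
      funext i
      simp [latticeVec]
    rw [h, add_dotProduct]
    exact add_nonneg (ha p hp x hx) (hb q hq x hx)
  add_mem' := by
    classical
    intro a b ha hb m hm
    rcases Finset.mem_union.1 (Finsupp.support_add hm) with h | h
    · exact ha m h
    · exact hb m h
  algebraMap_mem' := by
    intro c m hm x _
    have h : m = 0 := by
      by_contra hne
      refine (Finsupp.mem_support_iff.1 hm) ?_
      rw [AddMonoidAlgebra.coe_algebraMap]
      simp [AddMonoidAlgebra.coeff_single, hne]
    subst h
    simp [latticeVec, dotProduct]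

/-- A closed subscheme of the toric variety, given by its ideal on every affine toric chart. -/
def ToricSubscheme {ι : Type*} [Fintype ι] (P : Set (ι → ℝ)) :=
  (F : {F : Set (ι → ℝ) // IsProperFace P F}) → Ideal (chartRing F.1)

/-! ### Torus invariant divisors

Here `P` is the convex hull of the lattice vectors `e j`, which are its vertices; the torus
invariant prime divisors `D_j` correspond to the `e j`, and `a : I → ℤ` stands for the
Weil divisor `∑ j, a j • D_j`. -/

/-- The sections of `O(∑ j, a j • D_j)` over the chart `U_F`: the Laurent polynomials whose order
along `D_j` is at least `- a j` for every `j` with `e j ∈ F`. -/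
def localSections {ι I : Type*} [Fintype ι] (e : I → ι → ℤ) (F : Set (ι → ℝ)) (a : I → ℤ) :
    Submodule ℂ (Laurent ι) :=
  AddMonoidAlgebra.supported ℂ ℂ {m | ∀ j, latticeVec (e j) ∈ F → -a j ≤ m ⬝ᵥ e j}

/-- The lattice points of the polytope of `a`: the exponents of the monomial global sections. -/
def sectionExponents {ι I : Type*} [Fintype ι] (e : I → ι → ℤ) (a : I → ℤ) : Set (ι → ℤ) :=
  {m | ∀ j, -a j ≤ m ⬝ᵥ e j}

/-- The global sections of `O(∑ j, a j • D_j)`. -/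
def globalSections {ι I : Type*} [Fintype ι] (e : I → ι → ℤ) (a : I → ℤ) :
    Submodule ℂ (Laurent ι) :=
  AddMonoidAlgebra.supported ℂ ℂ (sectionExponents e a)

/-- The divisor `D` is Cartier: `O(D) · O(-D) = O` on every chart. (Where a product of a section
of `O(D)` and a section of `O(-D)` is invertible, either factor is a local equation for `D` up to
sign, so this says that `D` is locally principal.) -/
def IsCartier {ι I : Type*} [Fintype ι] (e : I → ι → ℤ) (a : I → ℤ) : Prop :=
  ∀ F, IsProperFace (hullOf e) F →
    localSections e F a * localSections e F (-a) = Subalgebra.toSubmodule (chartRing F)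

/-- `O(D)` is generated by its global sections on every chart. -/
def IsGloballyGenerated {ι I : Type*} [Fintype ι] (e : I → ι → ℤ) (a : I → ℤ) : Prop :=
  ∀ F, IsProperFace (hullOf e) F →
    globalSections e a * Subalgebra.toSubmodule (chartRing F) = localSections e F a

/-- Some positive multiple of `D` is globally generated. -/
def IsSemiample {ι I : Type*} [Fintype ι] (e : I → ι → ℤ) (a : I → ℤ) : Prop :=
  ∃ l : ℕ, 0 < l ∧ IsGloballyGenerated e (l • a)

/-- Linear equivalence of torus invariant divisors: the difference is the divisor of a
character. -/
def LinEquivalent {ι I : Type*} [Fintype ι] (e : I → ι → ℤ) (a b : I → ℤ) : Prop :=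
  ∃ m : ι → ℤ, ∀ j, a j - b j = m ⬝ᵥ e j

/-- Ampleness of a Cartier divisor `D`: every chart `U_F` is the non-vanishing locus of a global
section `s` of some positive multiple `l D`. Indeed `s` vanishes nowhere on `U_F` iff it generates
`O(l D)` there, and then `U_F` is the whole non-vanishing locus iff every function on `U_F` becomes
a global section of some `q l D` when multiplied by `s ^ q`. -/
def IsAmple {ι I : Type*} [Fintype ι] (e : I → ι → ℤ) (a : I → ℤ) : Prop :=
  ∀ F, IsProperFace (hullOf e) F →
    ∃ l : ℕ, 0 < l ∧ ∃ s ∈ globalSections e (l • a),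
      (∀ f : Laurent ι, f ∈ localSections e F (l • a) ↔ ∃ h ∈ chartRing F, f = s * h) ∧
      ∀ h ∈ chartRing F, ∃ q : ℕ, s ^ q * h ∈ globalSections e (q • l • a)

/-- The class of `D` is an ample generator of the Picard group: `D` is an ample Cartier divisor,
and every torus invariant Cartier divisor is linearly equivalent to a multiple of `D`. -/
def IsAmpleGenerator {ι I : Type*} [Fintype ι] (e : I → ι → ℤ) (a : I → ℤ) : Prop :=
  IsCartier e a ∧ IsAmple e a ∧ ∀ b, IsCartier e b → ∃ c : ℤ, LinEquivalent e b (c • a)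

/-- The reduced divisor `∑ j ∈ A, D_j`. -/
def divisorOf {I : Type*} (A : Set I) : I → ℤ := A.indicator 1

/-! ### Generic complete intersections -/

/-- The filter of sets of coefficient vectors that contain a non-empty Zariski open set
(`s` is finite in all uses). -/
def genericFilter (s : Type*) : Filter (s → ℂ) where
  sets := {U | ∃ p : MvPolynomial s ℂ, p ≠ 0 ∧ ∀ c, MvPolynomial.eval c p ≠ 0 → c ∈ U}
  univ_sets := ⟨1, one_ne_zero, fun _ _ => trivial⟩
  sets_of_superset := by
    rintro U V ⟨p, hp, h⟩ hUV
    exact ⟨p, hp, fun c hc => hUV (h c hc)⟩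
  inter_sets := by
    rintro U V ⟨p, hp, h⟩ ⟨q, hq, h'⟩
    refine ⟨p * q, mul_ne_zero hp hq, fun c hc => ?_⟩
    rw [map_mul] at hc
    exact ⟨h c (left_ne_zero_of_mul hc), h' c (right_ne_zero_of_mul hc)⟩

/-- A generic member of a family of closed subschemes of a toric variety: the ambient toric variety
is the one of the fan over the faces of `polytope`, and `members` is the filter of the properties
(sets of subschemes) that hold for the generic member of the family. -/
structure GenericSubscheme (ι : Type*) [Fintype ι] where
  polytope : Set (ι → ℝ)
  members : Filter (ToricSubscheme polytope)

/-- The compactified complete intersection `g 0 = ⋯ = g (r - 1) = 0`: the scheme-theoretic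
intersection of the closures, in the toric variety, of the hypersurfaces `g i = 0` of the torus. -/
def compactified {ι : Type*} [Fintype ι] (P : Set (ι → ℝ)) {r : ℕ} (g : Fin r → Laurent ι) :
    ToricSubscheme P :=
  fun F => ⨆ i, (Ideal.span {g i}).comap (chartRing F.1).val.toRingHom

/-- The Laurent polynomial with given coefficients at the lattice points of `Q`. -/
def laurentOf {ι : Type*} (Q : Set (ι → ℝ)) (c : latticePoints Q → ℂ) : Laurent ι :=
  ∑ᶠ m : latticePoints Q, AddMonoidAlgebra.single m.1 (c m)

/-- The compactified generic complete intersection of `r` generic Laurent polynomials with Newton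
polytopes `Q 0, …, Q (r - 1)`, in the toric variety of the fan over the faces of `P`. -/
def genericCompactified {ι : Type*} [Fintype ι] (P : Set (ι → ℝ)) {r : ℕ}
    (Q : Fin r → Set (ι → ℝ)) : GenericSubscheme ι where
  polytope := P
  members := Filter.map (fun c => compactified P fun i => laurentOf (Q i) fun m => c ⟨i, m⟩)
    (genericFilter (Σ i, latticePoints (Q i)))

/-! ### Nef-partitions and the Batyrev–Borisov mirror -/

/-- The vertices `e j` of a reflexive polytope, partitioned into the sets `parts i` of indices such
that every `∑ j ∈ parts i, D_j` is a semi-ample Cartier divisor. -/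
def IsNefPartition {ι I : Type*} [Fintype ι] (e : I → ι → ℤ) {r : ℕ} (parts : Fin r → Set I) :
    Prop :=
  IsReflexive (hullOf e) ∧
  Function.Injective e ∧
  (Set.range fun j => latticeVec (e j)) = (hullOf e).extremePoints ℝ ∧
  (Pairwise fun i i' => Disjoint (parts i) (parts i')) ∧
  (⋃ i, parts i) = Set.univ ∧
  ∀ i, IsCartier e (divisorOf (parts i)) ∧ IsSemiample e (divisorOf (parts i))

/-- The supporting polytope of the global sections of `O(∑ j ∈ A, D_j)`. -/
def sectionPolytope {ι I : Type*} [Fintype ι] (e : I → ι → ℤ) (A : Set I) : Set (ι → ℝ) :=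
  {y | ∀ j, -(divisorOf A j : ℝ) ≤ y ⬝ᵥ latticeVec (e j)}

/-- The convex hull of `0` and the vertices `e j` with `j ∈ A`. -/
def nablaOf {ι I : Type*} (e : I → ι → ℤ) (A : Set I) : Set (ι → ℝ) :=
  convexHull ℝ (insert 0 ((fun j => latticeVec (e j)) '' A))

/-- `Ystar` is the mirror of `Y` with respect to the nef-partition `parts`:
`Y` is the compactified generic complete intersection `g_i = 0` in the Gorenstein toric Fano variety
of the fan over the faces of `hullOf e`, where `g_i` has as Newton polytope the supporting polytope
of the sections of `O(∑ j ∈ parts i, D_j)`, and `Ystar` is the compactified generic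
complete intersection `h_i = 0`, where `h_i` has the Newton polytope `∇_i = nablaOf e (parts i)`, in
the toric variety whose fan is the normal fan of `∇ = ∑ ∇_i`, that is, the fan over the faces of
the polar dual of `∇`. -/
def IsBatyrevBorisovMirror {ι I : Type*} [Fintype ι] (e : I → ι → ℤ) {r : ℕ}
    (parts : Fin r → Set I) (Y Ystar : GenericSubscheme ι) : Prop :=
  IsNefPartition e parts ∧
  Y = genericCompactified (hullOf e) (fun i => sectionPolytope e (parts i)) ∧
  Ystar = genericCompactified (polarDual (minkowskiSum fun i => nablaOf e (parts i)))
    (fun i => nablaOf e (parts i))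

/-! ### Hypersurface sections in the embedding by a complete linear system -/

/-- The exponents of the monomials of degree `d` in homogeneous coordinates `z_m`, one for each
monomial section `m` of `O(H)`. -/
abbrev DegreeMonomial {ι I : Type*} [Fintype ι] (e : I → ι → ℤ) (H : I → ℤ) (d : ℕ) :=
  {α : sectionExponents e H →₀ ℕ // α.degree = d}

/-- The homogeneous form of degree `d` in the `z_m` with given coefficients. -/
def formOf {ι I : Type*} [Fintype ι] (e : I → ι → ℤ) (H : I → ℤ) (d : ℕ)
    (c : DegreeMonomial e H d → ℂ) : MvPolynomial (sectionExponents e H) ℂ :=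
  ∑ᶠ α : DegreeMonomial e H d, MvPolynomial.monomial α.1 (c α)

/-- The restriction of a form of degree `d`, as a section of `O(d H)`: substitute for each
homogeneous coordinate `z_m` the section of `O(H)` it is. -/
def restrictForm {ι I : Type*} [Fintype ι] (e : I → ι → ℤ) (H : I → ℤ)
    (f : MvPolynomial (sectionExponents e H) ℂ) : Laurent ι :=
  MvPolynomial.aeval (fun m : sectionExponents e H => character m.1) f

/-- The intersection of the toric variety with the hypersurfaces `f i = 0` of degrees `d i`. On the
chart `U_F` the ideal of the zero scheme of a section `s` of `O(d H)` consists of the products of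
`s` and sections of `O(-d H)`. -/
def hypersurfaceIntersection {ι I : Type*} [Fintype ι] (e : I → ι → ℤ) (H : I → ℤ) {r : ℕ}
    (d : Fin r → ℕ) (f : Fin r → MvPolynomial (sectionExponents e H) ℂ) :
    ToricSubscheme (hullOf e) :=
  fun F => Ideal.span {x | ∃ i, ∃ b ∈ localSections e F.1 (-(d i • H)),
    (x : Laurent ι) = restrictForm e H (f i) * b}

/-- The intersection of the toric variety with generic hypersurfaces of degrees `d i` in
the projective space of the complete linear system `|H|`. -/
def genericHypersurfaceIntersection {ι I : Type*} [Fintype ι] (e : I → ι → ℤ) (H : I → ℤ) {r : ℕ}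
    (d : Fin r → ℕ) : GenericSubscheme ι where
  polytope := hullOf e
  members := Filter.map
    (fun c => hypersurfaceIntersection e H d fun i => formOf e H (d i) fun α => c ⟨i, α⟩)
    (genericFilter (Σ i, DegreeMonomial e H (d i)))

/-! ### The toric degeneration `P(k,n)` of the Grassmannian `G(k,n)` -/

/-- Indices of the lattice vectors `u_{1,0}`, `u_{i,j}` (`2 ≤ i ≤ k`, `0 ≤ j ≤ n-k-1`),
`v_{i,j}` (`1 ≤ i ≤ k`, `1 ≤ j ≤ n-k-1`) and `v_{k,n-k}`. -/
inductive GVertex (k n : ℕ) : Type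
  | uFirst : GVertex k n
  | u (i j : ℕ) (hi : 2 ≤ i) (hik : i ≤ k) (hj : j + 1 ≤ n - k) : GVertex k n
  | v (i j : ℕ) (hi : 1 ≤ i) (hik : i ≤ k) (hj : 1 ≤ j) (hjn : j + 1 ≤ n - k) : GVertex k n
  | vLast : GVertex k n

/-- The basis vector `f_{i,j}` of `ℤ^{k(n-k)}`, for `1 ≤ i ≤ k` and `1 ≤ j ≤ n-k`. -/
def fVec (k n i j : ℕ) : Fin k × Fin (n - k) → ℤ :=
  fun p => if (p.1 : ℕ) + 1 = i ∧ (p.2 : ℕ) + 1 = j then 1 else 0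

/-- The lattice vectors `u_{i,j}` and `v_{i,j}`. The polytope `Δ(k,n)` is
`hullOf (gVec k n)`, and `P(k,n)` is the toric variety of the fan over its faces. -/
def gVec (k n : ℕ) : GVertex k n → (Fin k × Fin (n - k) → ℤ)
  | .uFirst => fVec k n 1 1
  | .u i j _ _ _ => fVec k n i (j + 1) - fVec k n (i - 1) (j + 1)
  | .v i j _ _ _ _ => fVec k n i (j + 1) - fVec k n i j
  | .vLast => -fVec k n k (n - k)

/-- The number `l` in `{1, …, n}` of the group `E_l` that a vertex belongs to: `E_1 = {u_{1,0}}`,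
`E_i = {u_{i,j}}_j` for `2 ≤ i ≤ k`, `E_{k+j} = {v_{i,j}}_i` for `1 ≤ j ≤ n-k-1`,
`E_n = {v_{k,n-k}}`. -/
def gGroup (k n : ℕ) : GVertex k n → ℕ
  | .uFirst => 1
  | .u i _ _ _ _ => i
  | .v _ j _ _ _ _ => k + j
  | .vLast => n

/-- The set `E_l` of vertices of `Δ(k,n)`. -/
def gE (k n l : ℕ) : Set (GVertex k n) := {ρ | gGroup k n ρ = l}

/-- The union of the groups `E_j` with `j ∈ A`. -/
def gMerged (k n : ℕ) (A : Finset ℕ) : Set (GVertex k n) := ⋃ j ∈ A, gE k n j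

end

/-!
The vertices of `Δ(k,n)` are the edges of a network: the nodes are the points `(i, j)` of the
`k × (n - k)` grid together with a source and a sink, and pairing a vector (a function on the grid,
extended by `0` to the source and the sink) with a vertex gives the difference of its values at the
two ends of the edge (`gridRes_dotProduct_gVec`). Everything then becomes a system of difference
constraints on this network. Every directed path from the source to the sink has `n` edges, one in
each group `E_l`: the edges of `E_l` are those across the `l`-th cut of the network, so that the
divisor `D(E_l)` is the coboundary of the indicator function `gridCut k l` of the nodes behind that
cut (`gridCut_sub`).

Adding a sum of cuts turns a vector in the polytope of a divisor into a function that is weakly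
increasing along the edges, with value `0` at the source and a fixed value at the sink
(`isFlowOrder_gridExt_add`). Such functions are bounded, which puts `0` in the interior of `Δ(k,n)`,
and they are non-negative combinations of indicator functions of up-sets of the grid
(`IsFlowOrder.gridRes_mem`); so up to translation all polytopes in question are multiples of the
order polytope of the grid, which has integral vertices. This gives the reflexivity of `Δ(k,n)` and
of the Minkowski sum `∇` (`isReflexive_hullOf_gVec`, `isReflexive_minkowskiSum_nablaOf`).

A proper face of `Δ(k,n)` is the set of edges on which such an increasing function `φ` from `0` to
`n` is constant. Rounding preserves the constraints: `⌊φ / n⌋` gives a monomial global section that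
generates `O(D(E_J))` on the chart of the face, so the `D(E_J)` are Cartier and globally generated,
and rounding a large multiple of `φ` keeps the other edges strict, which gives ampleness
(`isAmple_divisorOf_gE`). One face contains all vertices but `u_{1,0}`; on it a Cartier divisor is
the divisor of a character, so it is linearly equivalent to a multiple of `D(E_1)`
(`IsCartier.exists_linEquivalent`).

For the complete intersections, an ample generator `H` is linearly equivalent to `D(E_1)`, and
`d H` to `D(E_J)` for `|J| = d`. An integral increasing function from `0` to `d` is the sum of the
`d` indicator functions of its superlevel sets, so forms of degree `d` restrict onto all sections of
`O(D(E_J))`. This restriction adds up coefficients over the fibres of a surjection of index sets,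
which takes generic coefficients to generic ones (`map_fiberSum_genericFilter`). Finally, a Laurent
polynomial with all coefficients non-zero attains the minimal order along every boundary divisor,
and so the closure of its zero set has the ideal of the zero scheme of the section
(`mem_localSections_of_mul`, `hypersurfaceIntersection_eq_compactified`).
-/

/-! ### Lattice vectors and polar duals -/

lemma latticeVec_dotProduct {ι : Type*} [Fintype ι] (m m' : ι → ℤ) :
    latticeVec m ⬝ᵥ latticeVec m' = ((m ⬝ᵥ m' : ℤ) : ℝ) := by
  simp [latticeVec, dotProduct]

lemma latticeVec_sum {ι I : Type*} (s : Finset I) (m : I → ι → ℤ) :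
    latticeVec (∑ i ∈ s, m i) = ∑ i ∈ s, latticeVec (m i) := by
  funext i; simp [latticeVec]

lemma convex_dotProduct_ge {ι : Type*} [Fintype ι] (y : ι → ℝ) (c : ℝ) :
    Convex ℝ {x : ι → ℝ | c ≤ y ⬝ᵥ x} := by
  intro x hx x' hx' a b ha hb hab
  simp only [Set.mem_ofPred_eq, dotProduct_add, dotProduct_smul, smul_eq_mul] at *
  have hc : c = a * c + b * c := by rw [← add_mul, hab, one_mul]
  rw [hc]
  gcongr

lemma convex_polarDual {ι : Type*} [Fintype ι] (P : Set (ι → ℝ)) : Convex ℝ (polarDual P) := by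
  intro y hy y' hy' a b ha hb hab x hx
  have h1 := hy x hx
  have h2 := hy' x hx
  rw [add_dotProduct, smul_dotProduct, smul_dotProduct, smul_eq_mul, smul_eq_mul]
  nlinarith

/-- Membership in the polar dual of a convex hull is tested on the generators. -/
lemma mem_polarDual_convexHull {ι : Type*} [Fintype ι] {S : Set (ι → ℝ)} {y : ι → ℝ} :
    y ∈ polarDual (convexHull ℝ S) ↔ ∀ x ∈ S, -1 ≤ y ⬝ᵥ x :=
  ⟨fun h x hx => h x (subset_convexHull ℝ S hx),
    fun h _ hx => convexHull_min (t := {x | -1 ≤ y ⬝ᵥ x}) h (convex_dotProduct_ge y _) hx⟩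

lemma linear_eq_dotProduct {ι : Type*} [Fintype ι] [DecidableEq ι] (f : (ι → ℝ) →L[ℝ] ℝ)
    (x : ι → ℝ) : f x = (fun i => f (Pi.single i 1)) ⬝ᵥ x := by
  conv_lhs => rw [pi_eq_sum_univ' x]
  simp [dotProduct, mul_comm, map_sum]

/-- A non-empty closed convex set with bounded polar dual contains the origin in its interior: a
small vector outside the set would be separated from it by a functional whose multiples violate the
bound. -/
lemma zero_mem_interior_of_polarDual_bounded {ι : Type*} [Fintype ι] {P : Set (ι → ℝ)}
    (hP : Convex ℝ P) (hc : IsClosed P) (hne : P.Nonempty) {C : ℝ}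
    (hC : ∀ y ∈ polarDual P, ∀ i, |y i| ≤ C) : (0 : ι → ℝ) ∈ interior P := by
  classical
  have hC0 : 0 ≤ C ∨ IsEmpty ι := by
    rcases isEmpty_or_nonempty ι with h | ⟨⟨i⟩⟩
    · exact Or.inr h
    · refine Or.inl ((abs_nonneg _).trans (hC 0 ?_ i))
      intro x _; simp
  rcases hC0 with hC0 | hι
  swap
  · obtain ⟨p, hp⟩ := hne
    have : P = Set.univ := Set.eq_univ_of_forall fun x => by rwa [Subsingleton.elim x p]
    rw [this, interior_univ]; trivial
  rw [mem_interior_iff_mem_nhds, Metric.mem_nhds_iff]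
  set K : ℝ := Fintype.card ι * (C + 1) + 1 with hK
  have hKpos : 0 < K := by positivity
  refine ⟨1 / K, by positivity, fun x hx => ?_⟩
  by_contra hxP
  obtain ⟨f, u, hfx, hfP⟩ := geometric_hahn_banach_point_closed hP hc hxP
  set y : ι → ℝ := fun i => f (Pi.single i 1) with hy
  have hf : ∀ z, f z = y ⬝ᵥ z := linear_eq_dotProduct f
  -- for `s > 0` with `s * u ≥ -1` the vector `s • y` lies in the polar dual
  have hmem : ∀ s : ℝ, 0 < s → -1 ≤ s * u → ∀ i, |s * y i| ≤ C := by
    intro s hs hsu i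
    refine hC (s • y) (fun z hz => ?_) i
    rw [smul_dotProduct, smul_eq_mul, ← hf]
    have := hfP z hz
    nlinarith
  have hxi : ∀ i, |x i| ≤ 1 / K := by
    intro i
    have h1 : ‖x‖ < 1 / K := by simpa using hx
    exact (norm_le_pi_norm x i).trans h1.le
  have hbound : ∀ s : ℝ, (∀ i, |s * y i| ≤ C) → -1 < s * f x := by
    intro s hs
    have h1 : |s * f x| ≤ ∑ _i : ι, C * (1 / K) := by
      rw [hf, dotProduct, Finset.mul_sum]
      refine (Finset.abs_sum_le_sum_abs _ _).trans (Finset.sum_le_sum fun i _ => ?_)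
      rw [← mul_assoc, abs_mul]
      exact mul_le_mul (hs i) (hxi i) (abs_nonneg _) hC0
    have h2 : ∑ _i : ι, C * (1 / K) < 1 := by
      rw [Finset.sum_const, Finset.card_univ, nsmul_eq_mul, ← mul_assoc, mul_one_div,
        div_lt_one hKpos, hK]
      have : (0 : ℝ) ≤ Fintype.card ι := by positivity
      nlinarith
    linarith [neg_abs_le (s * f x)]
  rcases le_or_gt 0 u with hu | hu
  · have hy0 : y = 0 := by
      funext i
      by_contra hne'
      have hpos : 0 < |y i| := abs_pos.2 hne'
      have h1 := hmem ((C + 1) / |y i|) (by positivity)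
        (by have : 0 ≤ (C + 1) / |y i| * u := by positivity
            linarith) i
      rw [abs_mul, abs_of_pos (by positivity), div_mul_cancel₀ _ hpos.ne'] at h1
      linarith
    obtain ⟨p, hp⟩ := hne
    have := hfP p hp
    rw [hf, hy0, zero_dotProduct] at hfx
    rw [hf, hy0, zero_dotProduct] at this
    linarith
  · have hs : -1 ≤ (1 / -u) * u := by
      rw [one_div, inv_neg, neg_mul, inv_mul_cancel₀ hu.ne]
    have h1 := hbound (1 / -u) (hmem _ (by simpa using hu) hs)
    have h2 := mul_lt_mul_of_pos_right h1 (neg_pos.2 hu)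
    rw [mul_right_comm, one_div, inv_mul_cancel₀ (neg_ne_zero.2 hu.ne), one_mul] at h2
    linarith

/-! ### Proper faces and their supporting functionals -/

/-- On the face of the hull where `y` attains the minimum `-1`, a functional is non-negative as soon
as it is so at the generators on the face: the other generators have weight zero in every convex
combination that lies on the face. -/
lemma dotProduct_nonneg_of_tight {ι I : Type*} [Fintype ι] {e : I → ι → ℤ} {y z : ι → ℝ}
    (hy : ∀ j, -1 ≤ y ⬝ᵥ latticeVec (e j))
    (hz : ∀ j, y ⬝ᵥ latticeVec (e j) = -1 → 0 ≤ z ⬝ᵥ latticeVec (e j))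
    {x : ι → ℝ} (hx : x ∈ hullOf e) (hxy : y ⬝ᵥ x = -1) : 0 ≤ z ⬝ᵥ x := by
  rw [hullOf, convexHull_range_eq_exists_affineCombination] at hx
  obtain ⟨s, w, hw0, hw1, rfl⟩ := hx
  rw [Finset.affineCombination_eq_linear_combination _ _ _ hw1] at hxy ⊢
  rw [dotProduct_sum] at hxy ⊢
  simp only [dotProduct_smul, smul_eq_mul] at hxy ⊢
  have h1 : ∑ j ∈ s, w j * (y ⬝ᵥ latticeVec (e j) + 1) = 0 := by
    simp only [mul_add, Finset.sum_add_distrib, mul_one, hxy, hw1]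
    norm_num
  have h2 := (Finset.sum_eq_zero_iff_of_nonneg fun j hj =>
    mul_nonneg (hw0 j hj) (by linarith [hy j])).1 h1
  refine Finset.sum_nonneg fun j hj => ?_
  rcases mul_eq_zero.1 (h2 j hj) with h | h
  · rw [h, zero_mul]
  · exact mul_nonneg (hw0 j hj) (hz j (by linarith))

/-- A proper face of a polytope around the origin is cut out by a functional with minimum `-1`
(by the zero functional if the face is empty). -/
lemma IsProperFace.exists_functional {ι I : Type*} [Fintype ι] {e : I → ι → ℤ}
    (h0 : (0 : ι → ℝ) ∈ interior (hullOf e)) {F : Set (ι → ℝ)} (hF : IsProperFace (hullOf e) F) :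
    ∃ y : ι → ℝ, (∀ j, -1 ≤ y ⬝ᵥ latticeVec (e j)) ∧
      (∀ x, x ∈ F ↔ x ∈ hullOf e ∧ y ⬝ᵥ x = -1) := by
  classical
  rcases F.eq_empty_or_nonempty with rfl | hne
  · exact ⟨0, by simp, by simp⟩
  obtain ⟨l, hl⟩ := hF.1 hne
  obtain ⟨x₀, hx₀⟩ := hne
  have hx₀' := hx₀
  rw [hl] at hx₀'
  have h0mem : (0 : ι → ℝ) ∈ hullOf e := interior_subset h0
  have hM0 : 0 ≤ l x₀ := by simpa using hx₀'.2 0 h0mem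
  have hM : 0 < l x₀ := by
    refine lt_of_le_of_ne hM0 fun hM => hF.2 ?_
    have hneg : ∀ x ∈ hullOf e, l x ≤ 0 := fun x hx => by rw [hM]; exact hx₀'.2 x hx
    obtain ⟨ε, hε, hball⟩ := Metric.mem_nhds_iff.1 (mem_interior_iff_mem_nhds.1 h0)
    have hl0 : ∀ x, l x ≤ 0 := by
      intro x
      have hpos : 0 < ε / (2 * (‖x‖ + 1)) := by positivity
      have hmem : (ε / (2 * (‖x‖ + 1))) • x ∈ hullOf e := by
        apply hball
        rw [mem_ball_zero_iff, norm_smul, Real.norm_of_nonneg hpos.le, div_mul_eq_mul_div,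
          div_lt_iff₀ (by positivity)]
        nlinarith [norm_nonneg x]
      have := hneg _ hmem
      rw [map_smul, smul_eq_mul] at this
      by_contra hcon
      have := mul_pos hpos (not_le.1 hcon)
      linarith
    rw [hl]
    refine Set.eq_of_subset_of_subset (fun x hx => hx.1) fun x hx => ⟨hx, fun y _ => ?_⟩
    have h1 := hl0 y
    have h2 := hl0 (-x)
    rw [map_neg] at h2
    linarith
  set y : ι → ℝ := fun i => -(l (Pi.single i 1)) / l x₀ with hy
  have hyx : ∀ x, y ⬝ᵥ x = -(l x / l x₀) := by
    intro x
    rw [linear_eq_dotProduct l x, hy]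
    simp only [dotProduct, Finset.sum_div, ← Finset.sum_neg_distrib]
    refine Finset.sum_congr rfl fun i _ => by ring
  refine ⟨y, fun j => ?_, fun x => ?_⟩
  · rw [hyx, neg_le_neg_iff, div_le_one hM]
    exact hx₀'.2 _ (subset_convexHull ℝ _ ⟨j, rfl⟩)
  · rw [hyx, neg_inj, div_eq_one_iff_eq hM.ne', hl]
    refine ⟨fun hx => ⟨hx.1, le_antisymm (hx₀'.2 x hx.1) (hx.2 x₀ hx₀'.1)⟩,
      fun hx => ⟨hx.1, fun z hz => by rw [hx.2]; exact hx₀'.2 z hz⟩⟩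

/-- The points of the polytope at which a functional with values `≥ -1` takes the value `-1` form
a proper face. -/
lemma isProperFace_of_functional {ι I : Type*} [Fintype ι] {e : I → ι → ℤ}
    (h0 : (0 : ι → ℝ) ∈ interior (hullOf e)) {y : ι → ℝ}
    (hy : ∀ j, -1 ≤ y ⬝ᵥ latticeVec (e j)) :
    IsProperFace (hullOf e) {x | x ∈ hullOf e ∧ y ⬝ᵥ x = -1} := by
  classical
  have hy' : y ∈ polarDual (hullOf e) := by
    refine mem_polarDual_convexHull.2 ?_
    rintro _ ⟨j, rfl⟩
    exact hy j
  refine ⟨fun hne => ?_, fun h => ?_⟩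
  · obtain ⟨x₀, hx₀⟩ := hne
    set l : (ι → ℝ) →L[ℝ] ℝ :=
      LinearMap.toContinuousLinearMap (dotProductBilin ℝ ℝ (-y)) with hl
    have hlx : ∀ x, l x = -(y ⬝ᵥ x) := fun x => by
      simp [hl, dotProductBilin]
    refine ⟨l, Set.ext fun x => ⟨fun hx => ⟨hx.1, fun z hz => ?_⟩, fun hx => ⟨hx.1, ?_⟩⟩⟩
    · rw [hlx, hlx, hx.2]
      linarith [hy' z hz]
    · have h1 := hx.2 x₀ hx₀.1
      rw [hlx, hlx, hx₀.2] at h1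
      linarith [hy' x hx.1]
  · have : (0 : ι → ℝ) ∈ hullOf e := interior_subset h0
    rw [← h] at this
    simpa using this.2

lemma latticeVec_mem_hullOf {ι I : Type*} (e : I → ι → ℤ) (j : I) :
    latticeVec (e j) ∈ hullOf e := subset_convexHull ℝ _ ⟨j, rfl⟩

lemma isProperFace_empty {ι I : Type*} [Fintype ι] {e : I → ι → ℤ}
    (h0 : (0 : ι → ℝ) ∈ interior (hullOf e)) : IsProperFace (hullOf e) ∅ :=
  ⟨fun h => absurd h Set.not_nonempty_empty, fun h => by
    have : (0 : ι → ℝ) ∈ hullOf e := interior_subset h0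
    rw [← h] at this
    exact this⟩

lemma mem_chartMonoid_iff {ι I : Type*} [Fintype ι] {e : I → ι → ℤ}
    (h0 : (0 : ι → ℝ) ∈ interior (hullOf e)) {F : Set (ι → ℝ)} (hF : IsProperFace (hullOf e) F)
    (m : ι → ℤ) : m ∈ chartMonoid F ↔ ∀ j, latticeVec (e j) ∈ F → 0 ≤ m ⬝ᵥ e j := by
  have hcast : ∀ j, 0 ≤ latticeVec m ⬝ᵥ latticeVec (e j) ↔ 0 ≤ m ⬝ᵥ e j := fun j => by
    rw [latticeVec_dotProduct]; exact_mod_cast Iff.rfl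
  refine ⟨fun h j hj => (hcast j).1 (h _ hj), fun h x hx => ?_⟩
  obtain ⟨y, hy, hyF⟩ := hF.exists_functional h0
  refine dotProduct_nonneg_of_tight hy (fun j hj => (hcast j).2 (h j ?_)) ((hyF x).1 hx).1
    ((hyF x).1 hx).2
  exact (hyF _).2 ⟨latticeVec_mem_hullOf e j, hj⟩

/-! ### Sections and exponent data of divisors -/

section Sections

variable {ι I : Type*} [Fintype ι] {e : I → ι → ℤ}

lemma mem_localSections {F : Set (ι → ℝ)} {a : I → ℤ} {f : Laurent ι} :
    f ∈ localSections e F a ↔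
      ∀ m, f.coeff m ≠ 0 → ∀ j, latticeVec (e j) ∈ F → -a j ≤ m ⬝ᵥ e j := by
  simp only [localSections, AddMonoidAlgebra.mem_supported, Set.subset_def, Finset.mem_coe,
    Finsupp.mem_support_iff, Set.mem_ofPred_eq]

lemma mem_globalSections {a : I → ℤ} {f : Laurent ι} :
    f ∈ globalSections e a ↔ ∀ m, f.coeff m ≠ 0 → ∀ j, -a j ≤ m ⬝ᵥ e j := by
  simp only [globalSections, sectionExponents, AddMonoidAlgebra.mem_supported, Set.subset_def,
    Finset.mem_coe, Finsupp.mem_support_iff, Set.mem_ofPred_eq]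

lemma mem_chartRing (h0 : (0 : ι → ℝ) ∈ interior (hullOf e)) {F : Set (ι → ℝ)}
    (hF : IsProperFace (hullOf e) F) {f : Laurent ι} :
    f ∈ chartRing F ↔ f ∈ localSections e F 0 := by
  rw [mem_localSections]
  change (∀ m ∈ f.coeff.support, m ∈ chartMonoid F) ↔ _
  simp only [Finsupp.mem_support_iff, mem_chartMonoid_iff h0 hF, Pi.zero_apply, neg_zero]

lemma exists_coeff_ne_zero_of_mul {f g : Laurent ι} {m : ι → ℤ} (h : (f * g).coeff m ≠ 0) :
    ∃ p q, f.coeff p ≠ 0 ∧ g.coeff q ≠ 0 ∧ p + q = m := by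
  classical
  obtain ⟨p, hp, q, hq, rfl⟩ := Finset.mem_add.1
    (AddMonoidAlgebra.support_coeff_mul_subset f g (Finsupp.mem_support_iff.2 h))
  exact ⟨p, q, Finsupp.mem_support_iff.1 hp, Finsupp.mem_support_iff.1 hq, rfl⟩

lemma mul_mem_localSections {F : Set (ι → ℝ)} {a b : I → ℤ} {f g : Laurent ι}
    (hf : f ∈ localSections e F a) (hg : g ∈ localSections e F b) :
    f * g ∈ localSections e F (a + b) := by
  rw [mem_localSections] at *
  intro m hm j hj
  obtain ⟨p, q, hp, hq, rfl⟩ := exists_coeff_ne_zero_of_mul hm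
  have h1 := hf p hp j hj
  have h2 := hg q hq j hj
  rw [add_dotProduct, Pi.add_apply]
  linarith

lemma globalSections_le_localSections (F : Set (ι → ℝ)) (a : I → ℤ) :
    globalSections e a ≤ localSections e F a := fun _ hf =>
  mem_localSections.2 fun m hm j _ => mem_globalSections.1 hf m hm j

lemma coeff_character_ne_zero {m p : ι → ℤ} : (character m).coeff p ≠ 0 ↔ p = m := by
  classical
  simp [character, Finsupp.single_apply, eq_comm]

omit [Fintype ι] in
lemma character_mul_character (m m' : ι → ℤ) :
    character m * character m' = character (m + m') := by
  simp [character]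

omit [Fintype ι] in
lemma character_neg_mul_cancel (m : ι → ℤ) (f : Laurent ι) :
    character (-m) * (character m * f) = f := by
  rw [← mul_assoc, character_mul_character, neg_add_cancel]
  exact one_mul f

omit [Fintype ι] in
lemma character_mul_neg_cancel (m : ι → ℤ) (f : Laurent ι) :
    character m * (character (-m) * f) = f := by
  rw [← mul_assoc, character_mul_character, add_neg_cancel]
  exact one_mul f

lemma character_mem_localSections {F : Set (ι → ℝ)} {a : I → ℤ} {m : ι → ℤ} :
    character m ∈ localSections e F a ↔ ∀ j, latticeVec (e j) ∈ F → -a j ≤ m ⬝ᵥ e j := by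
  simp only [mem_localSections, coeff_character_ne_zero, forall_eq]

lemma character_mem_globalSections {a : I → ℤ} {m : ι → ℤ} :
    character m ∈ globalSections e a ↔ ∀ j, -a j ≤ m ⬝ᵥ e j := by
  simp only [mem_globalSections, coeff_character_ne_zero, forall_eq]

/-- Multiplication by a character identifies the sections of two divisors that differ by the
divisor of the character. -/
lemma character_mul_mem_localSections {F : Set (ι → ℝ)} {a b : I → ℤ} {m : ι → ℤ}
    (h : ∀ j, latticeVec (e j) ∈ F → a j - b j = m ⬝ᵥ e j) {f : Laurent ι} :
    character m * f ∈ localSections e F b ↔ f ∈ localSections e F a := by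
  have key : ∀ {a b : I → ℤ} {m : ι → ℤ}, (∀ j, latticeVec (e j) ∈ F → a j - b j = m ⬝ᵥ e j) →
      ∀ {f : Laurent ι}, f ∈ localSections e F a → character m * f ∈ localSections e F b := by
    intro a b m h f hf
    rw [mem_localSections] at *
    intro p hp j hj
    obtain ⟨p', q, hp', hq, rfl⟩ := exists_coeff_ne_zero_of_mul hp
    rw [coeff_character_ne_zero.1 hp', add_dotProduct, ← h j hj]
    linarith [hf q hq j hj]
  refine ⟨fun hf => ?_, key h⟩
  have := key (a := b) (b := a) (m := -m)
    (fun j hj => by rw [neg_dotProduct, ← h j hj]; ring) hf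
  rwa [character_neg_mul_cancel] at this

variable (h0 : (0 : ι → ℝ) ∈ interior (hullOf e))
include h0

/-- A divisor with a local equation that is a character on every chart is Cartier. -/
lemma isCartier_of_exponents {a : I → ℤ}
    (h : ∀ F, IsProperFace (hullOf e) F →
      ∃ m : ι → ℤ, ∀ j, latticeVec (e j) ∈ F → m ⬝ᵥ e j = -a j) : IsCartier e a := by
  intro F hF
  obtain ⟨m, hm⟩ := h F hF
  apply le_antisymm
  · refine Submodule.mul_le.2 fun f hf g hg => ?_
    rw [Subalgebra.mem_toSubmodule, mem_chartRing h0 hF]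
    simpa using mul_mem_localSections hf hg
  · intro f hf
    rw [Subalgebra.mem_toSubmodule, mem_chartRing h0 hF] at hf
    rw [← character_mul_neg_cancel m f]
    refine Submodule.mul_mem_mul (character_mem_localSections.2 fun j hj => (hm j hj).ge) ?_
    refine (character_mul_mem_localSections (a := 0) fun j hj => ?_).2 hf
    rw [neg_dotProduct, hm j hj]
    simp

omit h0 in
/-- A Cartier divisor has a local equation that is a character on every chart: the product
decomposition of `1` contains two monomials that are inverse to each other. -/
lemma IsCartier.exists_exponent {a : I → ℤ} (ha : IsCartier e a) {F : Set (ι → ℝ)}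
    (hF : IsProperFace (hullOf e) F) :
    ∃ m : ι → ℤ, ∀ j, latticeVec (e j) ∈ F → m ⬝ᵥ e j = -a j := by
  by_contra hcon
  push Not at hcon
  have h1 : (1 : Laurent ι) ∈ localSections e F a * localSections e F (-a) := by
    rw [ha F hF]
    exact (chartRing F).one_mem
  have hle : localSections e F a * localSections e F (-a) ≤
      AddMonoidAlgebra.supported ℂ ℂ {m | m ≠ 0} := by
    refine Submodule.mul_le.2 fun f hf g hg => ?_
    rw [AddMonoidAlgebra.mem_supported]
    intro m hm hm0
    obtain ⟨p, q, hp, hq, hpq⟩ :=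
      exists_coeff_ne_zero_of_mul (Finsupp.mem_support_iff.1 (Finset.mem_coe.1 hm))
    obtain ⟨j, hj, hne⟩ := hcon p
    have h2 := mem_localSections.1 hf p hp j hj
    have h3 := mem_localSections.1 hg q hq j hj
    have h4 : p ⬝ᵥ e j + q ⬝ᵥ e j = 0 := by
      rw [← add_dotProduct, hpq, hm0, zero_dotProduct]
    rw [Pi.neg_apply] at h3
    apply hne
    linarith
  have h2 := AddMonoidAlgebra.mem_supported.1 (hle h1)
  have h3 : (0 : ι → ℤ) ∈ ((1 : Laurent ι).coeff.support : Set (ι → ℤ)) := by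
    rw [Finset.mem_coe, Finsupp.mem_support_iff]
    exact coeff_character_ne_zero.2 rfl
  exact h2 h3 rfl

/-- If on every chart a monomial global section is a local generator, the divisor is globally
generated. -/
lemma isGloballyGenerated_of_exponents {a : I → ℤ}
    (h : ∀ F, IsProperFace (hullOf e) F →
      ∃ m ∈ sectionExponents e a, ∀ j, latticeVec (e j) ∈ F → m ⬝ᵥ e j = -a j) :
    IsGloballyGenerated e a := by
  intro F hF
  obtain ⟨m, hmg, hm⟩ := h F hF
  apply le_antisymm
  · refine Submodule.mul_le.2 fun f hf g hg => ?_
    rw [Subalgebra.mem_toSubmodule, mem_chartRing h0 hF] at hg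
    simpa using mul_mem_localSections (globalSections_le_localSections F a hf) hg
  · intro f hf
    rw [← character_mul_neg_cancel m f]
    refine Submodule.mul_mem_mul (character_mem_globalSections.2 hmg) ?_
    rw [Subalgebra.mem_toSubmodule, mem_chartRing h0 hF]
    refine (character_mul_mem_localSections (a := a) fun j hj => ?_).2 hf
    rw [neg_dotProduct, hm j hj]
    simp

/-- If for every proper face some monomial section of a multiple of the divisor attains the minimal
order exactly along the components through that face, the divisor is ample. -/
lemma isAmple_of_exponents [Finite I] {a : I → ℤ}
    (h : ∀ F, IsProperFace (hullOf e) F → ∃ l : ℕ, 0 < l ∧ ∃ m : ι → ℤ,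
      ∀ j, -(l * a j) ≤ m ⬝ᵥ e j ∧ (m ⬝ᵥ e j = -(l * a j) ↔ latticeVec (e j) ∈ F)) :
    IsAmple e a := by
  classical
  have := Fintype.ofFinite I
  intro F hF
  obtain ⟨l, hl, m, hm⟩ := h F hF
  refine ⟨l, hl, character m, character_mem_globalSections.2 fun j => ?_, fun f => ?_,
    fun f hf => ?_⟩
  · simpa using (hm j).1
  · have hshift : ∀ g : Laurent ι, character m * g ∈ localSections e F (l • a) ↔
        g ∈ localSections e F 0 := fun g =>
      character_mul_mem_localSections fun j hj => by
        rw [((hm j).2).2 hj]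
        simp
    constructor
    · intro hf
      refine ⟨character (-m) * f, ?_, (character_mul_neg_cancel m f).symm⟩
      rwa [mem_chartRing h0 hF, ← hshift, character_mul_neg_cancel]
    · rintro ⟨g, hg, rfl⟩
      rwa [hshift, ← mem_chartRing h0 hF]
  · rw [mem_chartRing h0 hF, mem_localSections] at hf
    -- off the face the monomial has positive excess order, so a large power absorbs all poles
    set q : ℕ := ∑ p ∈ f.coeff.support, ∑ j, (p ⬝ᵥ e j).natAbs with hq
    refine ⟨q, ?_⟩
    rw [mem_globalSections]
    intro p hp j
    have hpow : (character m) ^ q = character (q • m) := by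
      simp [character, AddMonoidAlgebra.single_pow]
    rw [hpow] at hp
    obtain ⟨p₁, p₂, hp₁, hp₂, rfl⟩ := exists_coeff_ne_zero_of_mul hp
    rw [coeff_character_ne_zero.1 hp₁, add_dotProduct, smul_dotProduct]
    change -(q • l • a j) ≤ _
    simp only [nsmul_eq_mul]
    by_cases hj : latticeVec (e j) ∈ F
    · have h1 := hf p₂ hp₂ j hj
      rw [((hm j).2).2 hj]
      simp only [Pi.zero_apply, neg_zero] at h1
      linarith
    · have h1 : -(l * a j) + 1 ≤ m ⬝ᵥ e j :=
        Int.add_one_le_iff.2 (lt_of_le_of_ne (hm j).1 fun h => hj ((hm j).2.1 h.symm))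
      have h2 : (p₂ ⬝ᵥ e j).natAbs ≤ q := by
        refine le_trans ?_ (Finset.single_le_sum (f := fun p => ∑ j, (p ⬝ᵥ e j).natAbs)
          (fun _ _ => Nat.zero_le _) (Finsupp.mem_support_iff.2 hp₂))
        exact Finset.single_le_sum (f := fun j => (p₂ ⬝ᵥ e j).natAbs)
          (fun _ _ => Nat.zero_le _) (Finset.mem_univ j)
      have h3 : -(q : ℤ) ≤ p₂ ⬝ᵥ e j := by omega
      nlinarith

omit h0 in
/-- The order along a torus invariant divisor is additive on products: multiplying `q` by a Laurent
polynomial of order exactly `-a j` along every `D_j` of the chart shifts orders by exactly that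
much. -/
lemma mem_localSections_of_mul {F : Set (ι → ℝ)} {a : I → ℤ} {g q : Laurent ι}
    (hg : g ∈ localSections e F a)
    (hexact : ∀ j, latticeVec (e j) ∈ F → ∃ m, g.coeff m ≠ 0 ∧ m ⬝ᵥ e j = -a j)
    (hgq : g * q ∈ localSections e F 0) : q ∈ localSections e F (-a) := by
  classical
  rw [mem_localSections] at *
  intro p hp j hj
  obtain ⟨m, hm, hmj⟩ := hexact j hj
  obtain ⟨p₀, hp₀, hmin⟩ := q.coeff.support.exists_min_image (fun p => p ⬝ᵥ e j)
    ⟨p, Finsupp.mem_support_iff.2 hp⟩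
  set A := g.coeff.support.filter (fun x => x ⬝ᵥ e j = -a j) with hA
  set B := q.coeff.support.filter (fun x => x ⬝ᵥ e j = p₀ ⬝ᵥ e j) with hB
  have hAne : A.Nonempty := ⟨m, Finset.mem_filter.2 ⟨Finsupp.mem_support_iff.2 hm, hmj⟩⟩
  have hBne : B.Nonempty := ⟨p₀, Finset.mem_filter.2 ⟨hp₀, rfl⟩⟩
  -- among the terms of minimal order, some sum of two exponents arises only once
  obtain ⟨x, hx, y, hy, hu⟩ := UniqueSums.uniqueAdd_of_nonempty hAne hBne
  rw [hA, Finset.mem_filter] at hx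
  rw [hB, Finset.mem_filter] at hy
  have hu' : UniqueAdd g.coeff.support q.coeff.support x y := by
    intro x' y' hx' hy' hxy
    have h1 := hg x' (Finsupp.mem_support_iff.1 hx') j hj
    have h2 := hmin y' hy'
    have h3 : x' ⬝ᵥ e j + y' ⬝ᵥ e j = x ⬝ᵥ e j + y ⬝ᵥ e j := by
      rw [← add_dotProduct, hxy, add_dotProduct]
    refine hu (Finset.mem_filter.2 ⟨hx', ?_⟩) (Finset.mem_filter.2 ⟨hy', ?_⟩) hxy
    · linarith [hx.2, hy.2]
    · linarith [hx.2, hy.2]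
  have hcoef : (g * q).coeff (x + y) ≠ 0 := by
    rw [AddMonoidAlgebra.coeff_mul_add_of_uniqueAdd hu']
    exact mul_ne_zero (Finsupp.mem_support_iff.1 hx.1) (Finsupp.mem_support_iff.1 hy.1)
  have h4 := hgq _ hcoef j hj
  rw [add_dotProduct, hx.2, hy.2] at h4
  have h5 := hmin p (Finsupp.mem_support_iff.2 hp)
  simp only [Pi.zero_apply, neg_zero, Pi.neg_apply, neg_neg] at *
  linarith

end Sections

/-! ### Generic coefficients -/

lemma mem_genericFilter {σ : Type*} {U : Set (σ → ℂ)} :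
    U ∈ genericFilter σ ↔
      ∃ p : MvPolynomial σ ℂ, p ≠ 0 ∧ ∀ c, MvPolynomial.eval c p ≠ 0 → c ∈ U := Iff.rfl

lemma exists_eval_ne_zero {σ : Type*} {p : MvPolynomial σ ℂ} (hp : p ≠ 0) :
    ∃ c, MvPolynomial.eval c p ≠ 0 := by
  by_contra h
  push Not at h
  exact hp (MvPolynomial.funext fun c => by simpa using h c)

/-- Generic coefficients are all non-zero. -/
lemma eventually_genericFilter_ne_zero (σ : Type*) [Finite σ] :
    ∀ᶠ c in genericFilter σ, ∀ s, c s ≠ 0 := by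
  have := Fintype.ofFinite σ
  refine mem_genericFilter.2 ⟨∏ s, MvPolynomial.X s,
    Finset.prod_ne_zero_iff.2 fun s _ => MvPolynomial.X_ne_zero s, fun c hc s => ?_⟩
  rw [map_prod, Finset.prod_ne_zero_iff] at hc
  simpa using hc s (Finset.mem_univ s)

lemma finsum_fiber_eq_sum {σ τ : Type*} [Fintype σ] [DecidableEq τ] (π : σ → τ) (c : σ → ℂ)
    (t : τ) : ∑ᶠ s : {s // π s = t}, c s = ∑ s, if π s = t then c s else 0 := by
  classical
  rw [finsum_eq_sum_of_fintype, ← Finset.sum_filter]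
  exact (Finset.sum_subtype _ (by simp) _).symm

/-- The linear surjection that adds up the coordinates over the fibres of a surjection of index
sets takes generic vectors to generic vectors. For the harder direction, a polynomial non-vanishing
locus upstairs is restricted to an affine section of the surjection through one of its points. -/
lemma map_fiberSum_genericFilter {σ τ : Type*} [Finite σ] {π : σ → τ}
    (hπ : Function.Surjective π) :
    Filter.map (fun c : σ → ℂ => fun t => ∑ᶠ s : {s // π s = t}, c s) (genericFilter σ) =
      genericFilter τ := by
  classical
  have := Fintype.ofFinite σ
  simp only [finsum_fiber_eq_sum]
  set g := Function.surjInv hπ with hg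
  have hgπ : ∀ t, π (g t) = t := Function.surjInv_eq hπ
  ext U
  rw [Filter.mem_map, mem_genericFilter, mem_genericFilter]
  constructor
  · rintro ⟨p, hp, hU⟩
    obtain ⟨c₀, hc₀⟩ := exists_eval_ne_zero hp
    -- the affine section that maps the fibre sums of `c₀` to `c₀` and moves only the coordinates
    -- chosen by `g`
    let sec : σ → MvPolynomial τ ℂ := fun s => MvPolynomial.C (c₀ s) +
      if g (π s) = s then
        MvPolynomial.X (π s) - MvPolynomial.C (∑ s', if π s' = π s then c₀ s' else 0) else 0
    have hsec : ∀ c, MvPolynomial.eval c (MvPolynomial.bind₁ sec p) =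
        MvPolynomial.eval (fun s => c₀ s + if g (π s) = s then
          c (π s) - ∑ s', (if π s' = π s then c₀ s' else 0) else 0) p := by
      intro c
      rw [← MvPolynomial.coe_aeval_eq_eval, ← MvPolynomial.coe_aeval_eq_eval]
      simp only [RingHom.coe_coe]
      rw [MvPolynomial.aeval_bind₁]
      congr 2
      funext s
      simp only [sec]
      split_ifs <;> simp
    refine ⟨MvPolynomial.bind₁ sec p, fun h => hc₀ ?_, fun c hc => ?_⟩
    · have := hsec fun t => ∑ s', if π s' = t then c₀ s' else 0
      rw [h, map_zero] at this
      simpa using this.symm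
    · rw [hsec] at hc
      have := hU _ hc
      rw [Set.mem_preimage] at this
      convert this using 1
      funext t
      have h1 : ∀ s, (if π s = t then (c₀ s + if g (π s) = s then
          c (π s) - ∑ s', (if π s' = π s then c₀ s' else 0) else 0) else 0) =
          (if π s = t then c₀ s else 0) + if s = g t then
            c t - ∑ s', (if π s' = t then c₀ s' else 0) else 0 := by
        intro s
        by_cases hs : π s = t
        · subst hs
          simp only [if_true, eq_comm (a := s)]
        · have : s ≠ g t := fun h => hs (by rw [h, hgπ])
          simp [hs, this]
      simp only [h1, Finset.sum_add_distrib, Finset.sum_ite_eq', Finset.mem_univ, if_true]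
      ring
  · rintro ⟨p, hp, hU⟩
    have heval : ∀ c : σ → ℂ, MvPolynomial.eval c (MvPolynomial.bind₁
        (fun t => ∑ s, if π s = t then (MvPolynomial.X s : MvPolynomial σ ℂ) else 0) p) =
        MvPolynomial.eval (fun t => ∑ s, if π s = t then c s else 0) p := by
      intro c
      rw [← MvPolynomial.coe_aeval_eq_eval, ← MvPolynomial.coe_aeval_eq_eval]
      simp only [RingHom.coe_coe]
      rw [MvPolynomial.aeval_bind₁]
      congr 2
      funext t
      rw [map_sum]
      refine Finset.sum_congr rfl fun s _ => ?_
      split_ifs <;> simp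
    refine ⟨MvPolynomial.bind₁
      (fun t => ∑ s, if π s = t then (MvPolynomial.X s : MvPolynomial σ ℂ) else 0) p,
      fun h => ?_, fun c hc => ?_⟩
    · obtain ⟨c₀, hc₀⟩ := exists_eval_ne_zero hp
      apply hc₀
      have := heval fun s => if s = g (π s) then c₀ (π s) else 0
      rw [h, map_zero] at this
      rw [this]
      congr 2
      funext t
      rw [Finset.sum_eq_single (g t)]
      · simp [hgπ]
      · intro s _ hs
        by_cases h' : π s = t
        · subst h'
          simp [hs]
        · simp [h']
      · simp
    · rw [heval] at hc
      exact hU _ hc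

/-! ### The grid network -/

section Network

/-- The source of the edge given by a vertex of `Δ(k,n)`. The vertices are the edges of a network
on the grid nodes `(i, j)`, `1 ≤ i ≤ k`, `1 ≤ j ≤ n - k`, with the extra source node `(1, 0)` and
the extra sink node `(k, n - k + 1)`. -/
def GVertex.tail {k n : ℕ} : GVertex k n → ℕ × ℕ
  | .uFirst => (1, 0)
  | .u i j _ _ _ => (i - 1, j + 1)
  | .v i j _ _ _ _ => (i, j)
  | .vLast => (k, n - k)

/-- The target of the edge given by a vertex of `Δ(k,n)`. -/
def GVertex.head {k n : ℕ} : GVertex k n → ℕ × ℕ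
  | .uFirst => (1, 1)
  | .u i j _ _ _ => (i, j + 1)
  | .v i j _ _ _ _ => (i, j + 1)
  | .vLast => (k, n - k + 1)

/-- The values of a function on the nodes of the network at the grid nodes. -/
def gridRes {R : Type*} (k n : ℕ) (φ : ℕ × ℕ → R) : Fin k × Fin (n - k) → R :=
  fun p => φ (p.1 + 1, p.2 + 1)

/-- A function on the nodes that vanishes at the source and has given values at the grid nodes
and at the sink. -/
def gridExt {R : Type*} [Zero R] {k n : ℕ} (c : R) (w : Fin k × Fin (n - k) → R) : ℕ × ℕ → R :=
  fun q => if h : (1 ≤ q.1 ∧ q.1 ≤ k) ∧ (1 ≤ q.2 ∧ q.2 ≤ n - k) then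
    w (⟨q.1 - 1, by omega⟩, ⟨q.2 - 1, by omega⟩) else if q = (k, n - k + 1) then c else 0

/-- A function on the nodes that is weakly increasing along the edges, with value `0` at the source
and `c` at the sink. -/
structure IsFlowOrder {R : Type*} [Zero R] [LE R] (k n : ℕ) (c : R) (φ : ℕ × ℕ → R) : Prop where
  source : φ (1, 0) = 0
  sink : φ (k, n - k + 1) = c
  mono : ∀ ρ : GVertex k n, φ ρ.tail ≤ φ ρ.head

lemma gridRes_gridExt {R : Type*} [Zero R] {k n : ℕ} (c : R) (w : Fin k × Fin (n - k) → R) :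
    gridRes k n (gridExt c w) = w := by
  funext p
  have h : (1 ≤ (p.1 : ℕ) + 1 ∧ (p.1 : ℕ) + 1 ≤ k) ∧
      (1 ≤ (p.2 : ℕ) + 1 ∧ (p.2 : ℕ) + 1 ≤ n - k) := by
    have := p.1.2
    have := p.2.2
    omega
  simp [gridRes, gridExt, h]

lemma gridExt_source {R : Type*} [Zero R] {k n : ℕ} (c : R) (w : Fin k × Fin (n - k) → R) :
    gridExt c w (1, 0) = 0 := by
  simp [gridExt]

lemma gridExt_sink {R : Type*} [Zero R] {k n : ℕ} (c : R) (w : Fin k × Fin (n - k) → R) :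
    gridExt c w (k, n - k + 1) = c := by
  simp [gridExt]

lemma gridRes_dotProduct_fVec {R : Type*} [CommRing R] {k n : ℕ} (φ : ℕ × ℕ → R) {i j : ℕ}
    (hi : 1 ≤ i) (hik : i ≤ k) (hj : 1 ≤ j) (hjn : j ≤ n - k) :
    gridRes k n φ ⬝ᵥ (fun p => ((fVec k n i j p : ℤ) : R)) = φ (i, j) := by
  rw [dotProduct, Finset.sum_eq_single (⟨i - 1, by omega⟩, ⟨j - 1, by omega⟩)]
  · simp [gridRes, fVec, Nat.sub_add_cancel hi, Nat.sub_add_cancel hj]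
  · rintro ⟨p, q⟩ _ hne
    have : ¬ ((p : ℕ) + 1 = i ∧ (q : ℕ) + 1 = j) := by
      rintro ⟨rfl, rfl⟩
      exact hne (by simp)
    simp [fVec, this]
  · simp

instance GVertex.instFinite {k n : ℕ} : Finite (GVertex k n) := by
  let f : GVertex k n → Option (Option ((Bool × Fin (k + 1)) × Fin (n + 1))) := fun ρ =>
    match ρ with
    | .uFirst => none
    | .vLast => some none
    | .u i j _ _ _ => some (some ((true, ⟨i, by omega⟩), ⟨j, by omega⟩))
    | .v i j _ _ _ _ => some (some ((false, ⟨i, by omega⟩), ⟨j, by omega⟩))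
  refine Finite.of_injective f ?_
  intro a b hab
  cases a <;> cases b <;> simp_all [f]

variable {k n : ℕ} (hk : 1 ≤ k) (hkn : k < n)
include hk hkn

/-- Pairing with a vertex of `Δ(k,n)` is the difference of a potential along an edge. -/
lemma gridRes_dotProduct_gVec {R : Type*} [CommRing R] {φ : ℕ × ℕ → R} (h0 : φ (1, 0) = 0)
    (h1 : φ (k, n - k + 1) = 0) (ρ : GVertex k n) :
    gridRes k n φ ⬝ᵥ (fun p => ((gVec k n ρ p : ℤ) : R)) = φ ρ.head - φ ρ.tail := by
  have hf : ∀ {i j : ℕ}, 1 ≤ i → i ≤ k → 1 ≤ j → j ≤ n - k →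
      gridRes k n φ ⬝ᵥ (fun p => ((fVec k n i j p : ℤ) : R)) = φ (i, j) :=
    fun a b c d => gridRes_dotProduct_fVec φ a b c d
  have hsub : ∀ a b : Fin k × Fin (n - k) → ℤ,
      (fun p => (((a - b) p : ℤ) : R)) = (fun p => ((a p : ℤ) : R)) - fun p => ((b p : ℤ) : R) := by
    intro a b; funext p; simp
  cases ρ with
  | uFirst =>
    simp only [gVec, GVertex.head, GVertex.tail]
    rw [hf le_rfl hk le_rfl (by omega), h0, sub_zero]
  | u i j hi hik hj =>
    simp only [gVec, GVertex.head, GVertex.tail]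
    rw [hsub, dotProduct_sub, hf (by omega) hik (by omega) (by omega),
      hf (by omega) (by omega) (by omega) (by omega)]
  | v i j hi hik hj hjn =>
    simp only [gVec, GVertex.head, GVertex.tail]
    rw [hsub, dotProduct_sub, hf hi hik (by omega) (by omega), hf hi hik hj (by omega)]
  | vLast =>
    simp only [gVec, GVertex.head, GVertex.tail]
    have hneg : (fun p => (((-fVec k n k (n - k)) p : ℤ) : R)) =
        -fun p => ((fVec k n k (n - k) p : ℤ) : R) := by funext p; simp
    rw [hneg, dotProduct_neg, hf hk le_rfl (by omega) le_rfl, h1, zero_sub]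

lemma gridRes_dotProduct_gVec_int {φ : ℕ × ℕ → ℤ} (h0 : φ (1, 0) = 0)
    (h1 : φ (k, n - k + 1) = 0) (ρ : GVertex k n) :
    gridRes k n φ ⬝ᵥ gVec k n ρ = φ ρ.head - φ ρ.tail := by
  simpa using gridRes_dotProduct_gVec hk hkn h0 h1 ρ

lemma dotProduct_gVec {R : Type*} [CommRing R] (y : Fin k × Fin (n - k) → R) (ρ : GVertex k n) :
    y ⬝ᵥ (fun p => ((gVec k n ρ p : ℤ) : R)) =
      gridExt 0 y ρ.head - gridExt 0 y ρ.tail := by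
  have := gridRes_dotProduct_gVec hk hkn (gridExt_source 0 y) (gridExt_sink 0 y) ρ
  rwa [gridRes_gridExt] at this

omit hk hkn in
/-- Every grid node lies on a directed path from the source to the sink. -/
lemma IsFlowOrder.bounds {R : Type*} [Zero R] [Preorder R] {c : R} {φ : ℕ × ℕ → R}
    (h : IsFlowOrder k n c φ) {i j : ℕ} (hi : 1 ≤ i) (hik : i ≤ k) (hj : 1 ≤ j)
    (hjn : j ≤ n - k) : 0 ≤ φ (i, j) ∧ φ (i, j) ≤ c := by
  have hu : ∀ i' i j, 1 ≤ i' → i' ≤ i → i ≤ k → 1 ≤ j → j ≤ n - k → φ (i', j) ≤ φ (i, j) := by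
    intro i' i j h1 h2
    induction i, h2 using Nat.le_induction with
    | base => intros; exact le_rfl
    | succ i hi ih =>
      intro h3 h4 h5
      refine (ih (by omega) h4 h5).trans ?_
      have := h.mono (.u (i + 1) (j - 1) (by omega) h3 (by omega))
      simpa [GVertex.tail, GVertex.head, Nat.sub_add_cancel h4] using this
  have hv : ∀ i j' j, 1 ≤ i → i ≤ k → 1 ≤ j' → j' ≤ j → j ≤ n - k → φ (i, j') ≤ φ (i, j) := by
    intro i j' j h1 h2 h3 h4
    induction j, h4 using Nat.le_induction with
    | base => intros; exact le_rfl
    | succ j hj ih =>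
      intro h5
      refine (ih (by omega)).trans ?_
      exact h.mono (.v i j h1 h2 (by omega) h5)
  constructor
  · rw [← h.source]
    exact (h.mono .uFirst).trans ((hu 1 i 1 le_rfl hi hik le_rfl (by omega)).trans
      (hv i 1 j hi hik le_rfl hj hjn))
  · rw [← h.sink]
    exact ((hv i j (n - k) hi hik hj hjn le_rfl).trans
      (hu i k (n - k) hi hik le_rfl (by omega) le_rfl)).trans (h.mono .vLast)

omit hk hkn in
lemma exists_grid_node {q : ℕ × ℕ} (hq : (1 ≤ q.1 ∧ q.1 ≤ k) ∧ (1 ≤ q.2 ∧ q.2 ≤ n - k)) :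
    ∃ p : Fin k × Fin (n - k), q = ((p.1 : ℕ) + 1, (p.2 : ℕ) + 1) :=
  ⟨(⟨q.1 - 1, by omega⟩, ⟨q.2 - 1, by omega⟩), by ext <;> simp <;> omega⟩

lemma GVertex.tail_eq (ρ : GVertex k n) : ρ.tail = (1, 0) ∨
    ∃ p : Fin k × Fin (n - k), ρ.tail = ((p.1 : ℕ) + 1, (p.2 : ℕ) + 1) := by
  cases ρ with
  | uFirst => exact Or.inl rfl
  | u i j hi hik hj => exact Or.inr (exists_grid_node (by simp [GVertex.tail]; omega))
  | v i j hi hik hj hjn => exact Or.inr (exists_grid_node (by simp [GVertex.tail]; omega))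
  | vLast => exact Or.inr (exists_grid_node (by simp [GVertex.tail]; omega))

lemma GVertex.head_eq (ρ : GVertex k n) : ρ.head = (k, n - k + 1) ∨
    ∃ p : Fin k × Fin (n - k), ρ.head = ((p.1 : ℕ) + 1, (p.2 : ℕ) + 1) := by
  cases ρ with
  | uFirst => exact Or.inr (exists_grid_node (by simp [GVertex.head]; omega))
  | u i j hi hik hj => exact Or.inr (exists_grid_node (by simp [GVertex.head]; omega))
  | v i j hi hik hj hjn => exact Or.inr (exists_grid_node (by simp [GVertex.head]; omega))
  | vLast => exact Or.inl rfl

omit hk hkn in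
lemma IsFlowOrder.gridRes_bounds {R : Type*} [Zero R] [Preorder R] {c : R} {φ : ℕ × ℕ → R}
    (h : IsFlowOrder k n c φ) (p : Fin k × Fin (n - k)) :
    0 ≤ φ ((p.1 : ℕ) + 1, (p.2 : ℕ) + 1) ∧ φ ((p.1 : ℕ) + 1, (p.2 : ℕ) + 1) ≤ c :=
  h.bounds (by omega) p.1.2 (by omega) p.2.2

lemma IsFlowOrder.nonneg {R : Type*} [Zero R] [Preorder R] {c : R} {φ : ℕ × ℕ → R}
    (h : IsFlowOrder k n c φ) : 0 ≤ c :=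
  have hb := h.bounds le_rfl hk le_rfl (by omega)
  hb.1.trans hb.2

lemma IsFlowOrder.tail_nonneg {R : Type*} [Zero R] [Preorder R] {c : R} {φ : ℕ × ℕ → R}
    (h : IsFlowOrder k n c φ) (ρ : GVertex k n) : 0 ≤ φ ρ.tail := by
  rcases ρ.tail_eq hk hkn with h' | ⟨p, h'⟩
  · rw [h', h.source]
  · rw [h']
    exact (h.gridRes_bounds p).1

/-! ### Cuts -/

omit hk hkn in
/-- The indicator function of the nodes behind the `l`-th cut; the edges that cross it are those of
the group `E_l`. The cuts `2 ≤ l ≤ k` separate rows, the others columns. -/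
def gridCut (k l : ℕ) (q : ℕ × ℕ) : ℤ :=
  if l ≤ 1 then (if 1 ≤ q.2 then 1 else 0)
  else if l ≤ k then (if l ≤ q.1 then 1 else 0)
  else (if l - k + 1 ≤ q.2 then 1 else 0)

/-- The sum of the indicator functions of a set of cuts. -/
def cutSum (k : ℕ) (A : Finset ℕ) (q : ℕ × ℕ) : ℤ := ∑ l ∈ A, gridCut k l q

lemma gridCut_sub {l : ℕ} (hl : l ∈ Finset.Icc 1 n) (ρ : GVertex k n) :
    gridCut k l ρ.head - gridCut k l ρ.tail = if gGroup k n ρ = l then 1 else 0 := by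
  rw [Finset.mem_Icc] at hl
  cases ρ <;> simp only [gridCut, GVertex.head, GVertex.tail, gGroup] <;> split_ifs <;> omega

omit hk hkn in
lemma gridCut_source (l : ℕ) : gridCut k l (1, 0) = 0 := by
  simp only [gridCut]
  split_ifs <;> omega

omit hk in
lemma gridCut_sink {l : ℕ} (hl : l ∈ Finset.Icc 1 n) : gridCut k l (k, n - k + 1) = 1 := by
  rw [Finset.mem_Icc] at hl
  simp only [gridCut]
  split_ifs <;> omega

omit hk hkn in
lemma cutSum_source (A : Finset ℕ) : cutSum k A (1, 0) = 0 :=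
  Finset.sum_eq_zero fun l _ => gridCut_source l

omit hk in
lemma cutSum_sink {A : Finset ℕ} (hA : A ⊆ Finset.Icc 1 n) :
    cutSum k A (k, n - k + 1) = A.card := by
  rw [cutSum, Finset.sum_congr rfl fun l hl => gridCut_sink hkn (hA hl)]
  simp

/-- The divisor of a union of groups is the coboundary of the sum of the corresponding cuts. -/
lemma cutSum_sub {A : Finset ℕ} (hA : A ⊆ Finset.Icc 1 n) (ρ : GVertex k n) :
    cutSum k A ρ.head - cutSum k A ρ.tail = divisorOf (gMerged k n A) ρ := by
  classical
  rw [cutSum, cutSum, ← Finset.sum_sub_distrib,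
    Finset.sum_congr rfl fun l hl => gridCut_sub hk hkn (hA hl) ρ, Finset.sum_ite_eq, divisorOf,
    Set.indicator_apply]
  have : ρ ∈ gMerged k n A ↔ gGroup k n ρ ∈ A := by simp [gMerged, gE]
  simp [this]

omit hk hkn in
lemma gMerged_singleton (l : ℕ) : gMerged k n {l} = gE k n l := by simp [gMerged]

lemma gGroup_mem (ρ : GVertex k n) : gGroup k n ρ ∈ Finset.Icc 1 n := by
  rw [Finset.mem_Icc]
  cases ρ <;> simp only [gGroup] <;> omega

lemma gMerged_Icc : gMerged k n (Finset.Icc 1 n) = Set.univ := by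
  refine Set.eq_univ_of_forall fun ρ => ?_
  simp only [gMerged, gE, Set.mem_iUnion, Set.mem_ofPred_eq]
  exact ⟨_, gGroup_mem hk hkn ρ, rfl⟩

/-- All edges cross exactly one cut. -/
lemma cutSum_Icc_sub (ρ : GVertex k n) :
    cutSum k (Finset.Icc 1 n) ρ.head - cutSum k (Finset.Icc 1 n) ρ.tail = 1 := by
  rw [cutSum_sub hk hkn subset_rfl, gMerged_Icc hk hkn, divisorOf, Set.indicator_univ,
    Pi.one_apply]

/-! ### The order polytope of the grid -/

omit hk hkn in
/-- The lattice points of the order polytope of the grid: indicator functions of up-sets. -/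
def orderPoints (k n : ℕ) : Set (Fin k × Fin (n - k) → ℤ) :=
  {χ | ∃ ψ, IsFlowOrder k n (1 : ℤ) ψ ∧ χ = gridRes k n ψ}

lemma isFlowOrder_gridCut {l : ℕ} (hl : l ∈ Finset.Icc 1 n) :
    IsFlowOrder k n (1 : ℤ) (gridCut k l) := by
  refine ⟨gridCut_source l, gridCut_sink hkn hl, fun ρ => ?_⟩
  have := gridCut_sub hk hkn hl ρ
  split_ifs at this <;> omega

lemma zero_mem_orderPoints : (0 : Fin k × Fin (n - k) → ℤ) ∈ orderPoints k n := by
  refine ⟨gridCut k n, isFlowOrder_gridCut hk hkn (Finset.mem_Icc.2 ⟨by omega, le_rfl⟩), ?_⟩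
  funext p
  have := p.2.2
  simp only [gridRes, gridCut, Pi.zero_apply]
  split_ifs <;> omega

open scoped Pointwise in
/-- A weakly increasing function on the network is a combination, with non-negative coefficients
that add up to its value at the sink, of indicator functions of up-sets: subtract the indicator
function of the set where the function is positive, times its least positive value. -/
lemma IsFlowOrder.gridRes_mem {c : ℝ} {φ : ℕ × ℕ → ℝ} (h : IsFlowOrder k n c φ) :
    ∃ w ∈ convexHull ℝ (latticeVec '' orderPoints k n), gridRes k n φ = c • w := by
  classical
  suffices hs : ∀ (N : ℕ) (c : ℝ) (φ : ℕ × ℕ → ℝ), IsFlowOrder k n c φ →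
      (Finset.univ.filter fun p => 0 < gridRes k n φ p).card ≤ N →
      gridRes k n φ ∈ c • convexHull ℝ (latticeVec '' orderPoints k n) by
    obtain ⟨w, hw, hw'⟩ := Set.mem_smul_set.1 (hs _ c φ h le_rfl)
    exact ⟨w, hw, hw'.symm⟩
  have hzero : (0 : Fin k × Fin (n - k) → ℝ) ∈
      convexHull ℝ (latticeVec '' orderPoints k n) := by
    refine subset_convexHull ℝ _ ⟨0, zero_mem_orderPoints hk hkn, ?_⟩
    funext i; simp [latticeVec]
  intro N
  induction N with
  | zero =>
    intro c φ h hN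
    refine Set.mem_smul_set.2 ⟨0, hzero, ?_⟩
    rw [smul_zero]
    funext p
    by_contra hne
    have hp : p ∈ Finset.univ.filter fun p => 0 < gridRes k n φ p :=
      Finset.mem_filter.2 ⟨Finset.mem_univ _,
        lt_of_le_of_ne (h.gridRes_bounds p).1 (by simpa using hne)⟩
    rw [Finset.card_eq_zero.1 (Nat.le_zero.1 hN)] at hp
    simp at hp
  | succ N ih =>
    intro c φ h hN
    rcases (Finset.univ.filter fun p => 0 < gridRes k n φ p).eq_empty_or_nonempty with he | hne
    · refine Set.smul_set_mono (subset_refl _) (ih c φ h ?_)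
      rw [he]; simp
    obtain ⟨p₀, hp₀, hmin⟩ := Finset.exists_min_image _ (gridRes k n φ) hne
    set t := gridRes k n φ p₀ with ht
    have htpos : 0 < t := (Finset.mem_filter.1 hp₀).2
    have htc : t ≤ c := (h.gridRes_bounds p₀).2
    have hhead : ∀ ρ : GVertex k n, 0 < φ ρ.head → t ≤ φ ρ.head := by
      intro ρ hρ
      rcases ρ.head_eq hk hkn with h' | ⟨p, h'⟩
      · rw [h', h.sink]; exact htc
      · rw [h'] at hρ ⊢
        exact hmin p (Finset.mem_filter.2 ⟨Finset.mem_univ _, hρ⟩)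
    set ψ : ℕ × ℕ → ℤ := fun q => if 0 < φ q then 1 else 0 with hψ
    have hψo : IsFlowOrder k n (1 : ℤ) ψ := by
      refine ⟨by simp [hψ, h.source], by simp [hψ, h.sink, htpos.trans_le htc], fun ρ => ?_⟩
      simp only [hψ]
      by_cases hρ : 0 < φ ρ.tail
      · rw [if_pos hρ, if_pos (hρ.trans_le (h.mono ρ))]
      · rw [if_neg hρ]
        split_ifs <;> simp
    have hφ' : IsFlowOrder k n (c - t) (fun q => φ q - t * ψ q) := by
      refine ⟨by simp [hψ, h.source], by simp [hψ, h.sink, htpos.trans_le htc], fun ρ => ?_⟩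
      have h1 := h.mono ρ
      have h2 := h.tail_nonneg hk hkn ρ
      have h3 := hhead ρ
      simp only [hψ]
      by_cases hρ : 0 < φ ρ.tail
      · rw [if_pos hρ, if_pos (hρ.trans_le h1)]
        simpa using h1
      · rw [if_neg hρ]
        split_ifs with h4
        · have := h3 h4
          push_cast
          linarith
        · simpa using h1
    have hmem := ih _ _ hφ' (by
      refine Nat.le_of_lt_succ (lt_of_lt_of_le (Finset.card_lt_card ?_) hN)
      refine (Finset.ssubset_iff_of_subset fun p hp => ?_).2 ⟨p₀, hp₀, ?_⟩
      · rw [Finset.mem_filter] at hp ⊢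
        refine ⟨hp.1, ?_⟩
        by_contra hcon
        have h1 : ¬ 0 < φ ((p.1 : ℕ) + 1, (p.2 : ℕ) + 1) := hcon
        have h2 := hp.2
        simp only [gridRes, hψ, if_neg h1] at h2
        apply h1
        simpa using h2
      · rw [Finset.mem_filter]
        rintro ⟨_, h2⟩
        have h1 : 0 < φ ((p₀.1 : ℕ) + 1, (p₀.2 : ℕ) + 1) := htpos
        simp only [gridRes, hψ, if_pos h1] at h2
        simp [ht, gridRes] at h2)
    have hsum : gridRes k n φ = t • latticeVec (gridRes k n ψ) +
        gridRes k n (fun q => φ q - t * ψ q) := by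
      funext p
      simp [gridRes, latticeVec]
    have hc : c = t + (c - t) := by ring
    rw [hsum, hc, (convex_convexHull ℝ _).add_smul htpos.le (by linarith)]
    refine Set.add_mem_add (Set.smul_mem_smul_set (subset_convexHull ℝ _ ⟨_, ?_, rfl⟩)) hmem
    exact ⟨ψ, hψo, rfl⟩

end Network

/-! ### Reflexivity of `Δ(k,n)` -/

lemma finite_of_abs_le {ι : Type*} [Fintype ι] {S : Set (ι → ℤ)} {C : ℝ}
    (h : ∀ m ∈ S, ∀ i, |(m i : ℝ)| ≤ C) : S.Finite := by
  classical
  refine (Set.finite_Icc (fun _ : ι => -⌈C⌉) (fun _ : ι => ⌈C⌉)).subset fun m hm => ?_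
  have h1 : ∀ i, |m i| ≤ ⌈C⌉ := fun i => by
    have := (h m hm i).trans (Int.le_ceil C)
    exact_mod_cast this
  exact ⟨fun i => (abs_le.1 (h1 i)).1, fun i => (abs_le.1 (h1 i)).2⟩

lemma isLatticePolytope_hullOf {ι I : Type*} [Finite I] (e : I → ι → ℤ) :
    IsLatticePolytope (hullOf e) := by
  classical
  refine ⟨(Set.finite_range e).toFinset, ?_⟩
  rw [Set.Finite.coe_toFinset, ← Set.range_comp]
  rfl

lemma IsLatticePolytope.isClosed {ι : Type*} [Finite ι] {P : Set (ι → ℝ)}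
    (h : IsLatticePolytope P) : IsClosed P := by
  obtain ⟨S, rfl⟩ := h
  exact (S.finite_toSet.image latticeVec).isClosed_convexHull ℝ

/-- A polar dual with bounded coordinates is a lattice polytope if it is contained in the convex
hull of its lattice points. -/
lemma isLatticePolytope_polarDual {ι : Type*} [Fintype ι] {P : Set (ι → ℝ)} {C : ℝ}
    (hC : ∀ y ∈ polarDual P, ∀ i, |y i| ≤ C)
    (h : polarDual P ⊆ convexHull ℝ (latticeVec '' latticePoints (polarDual P))) :
    IsLatticePolytope (polarDual P) := by
  have hfin : (latticePoints (polarDual P)).Finite :=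
    finite_of_abs_le fun m hm i => hC (latticeVec m) hm i
  refine ⟨hfin.toFinset, ?_⟩
  rw [Set.Finite.coe_toFinset]
  refine h.antisymm (convexHull_min ?_ (convex_polarDual P))
  rintro _ ⟨m, hm, rfl⟩
  exact hm

lemma smul_sub_mem_convexHull {E : Type*} [AddCommGroup E] [Module ℝ E] {T S : Set E} {c : ℝ}
    {r : E} (h : ∀ x ∈ T, c • x - r ∈ convexHull ℝ S) {w : E} (hw : w ∈ convexHull ℝ T) :
    c • w - r ∈ convexHull ℝ S := by
  refine convexHull_min (t := {x | c • x - r ∈ convexHull ℝ S}) h ?_ hw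
  intro x hx x' hx' a b ha hb hab
  have : c • (a • x + b • x') - r = a • (c • x - r) + b • (c • x' - r) := by
    have hr : r = a • r + b • r := by rw [← add_smul, hab, one_smul]
    nth_rewrite 1 [hr]
    module
  rw [Set.mem_ofPred_eq, this]
  exact convex_convexHull ℝ S hx hx' ha hb hab

section Delta

variable {k n : ℕ} (hk : 1 ≤ k) (hkn : k < n)
include hk hkn

lemma dotProduct_latticeVec_gVec (y : Fin k × Fin (n - k) → ℝ) (ρ : GVertex k n) :
    y ⬝ᵥ latticeVec (gVec k n ρ) = gridExt 0 y ρ.head - gridExt 0 y ρ.tail :=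
  dotProduct_gVec hk hkn y ρ

/-- A vector that satisfies the inequalities of a divisor becomes an increasing function on the
network after adding a potential of the divisor. -/
lemma isFlowOrder_gridExt_add {c : ℝ} {κ : ℕ × ℕ → ℝ} (h0 : κ (1, 0) = 0)
    (h1 : κ (k, n - k + 1) = c) {y : Fin k × Fin (n - k) → ℝ}
    (hy : ∀ ρ : GVertex k n, -(κ ρ.head - κ ρ.tail) ≤ y ⬝ᵥ latticeVec (gVec k n ρ)) :
    IsFlowOrder k n c (fun q => gridExt 0 y q + κ q) := by
  refine ⟨by simp [gridExt_source, h0], by simp [gridExt_sink, h1], fun ρ => ?_⟩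
  have := hy ρ
  rw [dotProduct_latticeVec_gVec hk hkn] at this
  linarith

omit hk in
lemma cutSum_Icc_sink : (cutSum k (Finset.Icc 1 n) (k, n - k + 1)) = n := by
  rw [cutSum_sink hkn subset_rfl]
  simp

lemma isFlowOrder_gridExt_add_cutSum {y : Fin k × Fin (n - k) → ℝ}
    (hy : ∀ ρ : GVertex k n, -1 ≤ y ⬝ᵥ latticeVec (gVec k n ρ)) :
    IsFlowOrder k n (n : ℝ) (fun q => gridExt 0 y q + cutSum k (Finset.Icc 1 n) q) := by
  refine isFlowOrder_gridExt_add hk hkn (κ := fun q => (cutSum k (Finset.Icc 1 n) q : ℝ))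
    (by simp [cutSum_source]) (by simp [cutSum_Icc_sink hkn]) fun ρ => ?_
  rw [← Int.cast_sub, cutSum_Icc_sub hk hkn ρ, Int.cast_one]
  exact hy ρ

/-- The polytope of a torus invariant divisor is bounded. -/
lemma exists_bound_of_le_dotProduct_gVec (a : GVertex k n → ℤ) :
    ∃ C : ℝ, ∀ y : Fin k × Fin (n - k) → ℝ,
      (∀ ρ, -(a ρ : ℝ) ≤ y ⬝ᵥ latticeVec (gVec k n ρ)) → ∀ p, |y p| ≤ C := by
  have := Fintype.ofFinite (GVertex k n)
  set A : ℝ := ∑ ρ, |(a ρ : ℝ)| with hA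
  have hA0 : 0 ≤ A := Finset.sum_nonneg fun _ _ => abs_nonneg _
  refine ⟨A * n, fun y hy p => ?_⟩
  set κ : ℕ × ℕ → ℝ := fun q => A * cutSum k (Finset.Icc 1 n) q with hκ
  have h0 : κ (1, 0) = 0 := by simp [hκ, cutSum_source]
  have h1 : κ (k, n - k + 1) = A * n := by simp [hκ, cutSum_Icc_sink hkn]
  have hd : ∀ ρ : GVertex k n, κ ρ.head - κ ρ.tail = A := fun ρ => by
    rw [hκ, ← mul_sub, ← Int.cast_sub, cutSum_Icc_sub hk hkn ρ, Int.cast_one, mul_one]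
  have hφ := isFlowOrder_gridExt_add hk hkn h0 h1 (y := y) fun ρ => by
    rw [hd]
    refine le_trans (neg_le_neg ?_) (hy ρ)
    exact (le_abs_self _).trans
      (Finset.single_le_sum (f := fun ρ => |(a ρ : ℝ)|) (fun _ _ => abs_nonneg _)
        (Finset.mem_univ ρ))
  have hκo : IsFlowOrder k n (A * n) κ := ⟨h0, h1, fun ρ => by linarith [hd ρ]⟩
  have h2 := hφ.gridRes_bounds p
  have h3 := hκo.gridRes_bounds p
  have h4 : gridExt 0 y ((p.1 : ℕ) + 1, (p.2 : ℕ) + 1) = y p :=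
    congrFun (gridRes_gridExt 0 y) p
  rw [h4] at h2
  rw [abs_le]
  constructor <;> linarith

omit hk hkn in
lemma mem_polarDual_hullOf_gVec {y : Fin k × Fin (n - k) → ℝ} :
    y ∈ polarDual (hullOf (gVec k n)) ↔ ∀ ρ, -1 ≤ y ⬝ᵥ latticeVec (gVec k n ρ) := by
  rw [hullOf, mem_polarDual_convexHull, Set.forall_mem_range]

lemma polarDual_hullOf_gVec_bounded :
    ∃ C : ℝ, ∀ y ∈ polarDual (hullOf (gVec k n)), ∀ p, |y p| ≤ C := by
  obtain ⟨C, hC⟩ := exists_bound_of_le_dotProduct_gVec hk hkn (1 : GVertex k n → ℤ)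
  refine ⟨C, fun y hy => hC y fun ρ => ?_⟩
  simpa using mem_polarDual_hullOf_gVec.1 hy ρ

lemma zero_mem_interior_hullOf_gVec :
    (0 : Fin k × Fin (n - k) → ℝ) ∈ interior (hullOf (gVec k n)) := by
  obtain ⟨C, hC⟩ := polarDual_hullOf_gVec_bounded hk hkn
  exact zero_mem_interior_of_polarDual_bounded (convex_convexHull ℝ _)
    (isLatticePolytope_hullOf _).isClosed ⟨_, latticeVec_mem_hullOf _ .uFirst⟩ hC

lemma card_smul_sub_cutSum_dotProduct {A : Finset ℕ} (hA : A ⊆ Finset.Icc 1 n)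
    {ψ : ℕ × ℕ → ℤ} (hψ : IsFlowOrder k n (1 : ℤ) ψ) (ρ : GVertex k n) :
    ((A.card : ℤ) • gridRes k n ψ - gridRes k n (cutSum k A)) ⬝ᵥ gVec k n ρ =
      A.card * (ψ ρ.head - ψ ρ.tail) - divisorOf (gMerged k n A) ρ := by
  have h : (A.card : ℤ) • gridRes k n ψ - gridRes k n (cutSum k A) =
      gridRes k n (fun q => A.card * ψ q - cutSum k A q) := by
    funext p; simp [gridRes]
  rw [h, gridRes_dotProduct_gVec_int hk hkn (by simp [hψ.source, cutSum_source])
    (by simp [hψ.sink, cutSum_sink hkn hA]), ← cutSum_sub hk hkn hA]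
  ring

/-- Lattice points of the order polytope give monomial sections of the divisors of unions of
groups. -/
lemma card_smul_sub_cutSum_mem {A : Finset ℕ} (hA : A ⊆ Finset.Icc 1 n)
    {χ : Fin k × Fin (n - k) → ℤ} (hχ : χ ∈ orderPoints k n) :
    (A.card : ℤ) • χ - gridRes k n (cutSum k A) ∈
      sectionExponents (gVec k n) (divisorOf (gMerged k n A)) := by
  obtain ⟨ψ, hψ, rfl⟩ := hχ
  intro ρ
  rw [card_smul_sub_cutSum_dotProduct hk hkn hA hψ]
  have := mul_nonneg (Int.natCast_nonneg A.card) (sub_nonneg.2 (hψ.mono ρ))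
  linarith

omit hk hkn in
lemma latticeVec_smul_sub {ι : Type*} (d : ℤ) (χ r : ι → ℤ) :
    latticeVec (d • χ - r) = (d : ℝ) • latticeVec χ - latticeVec r := by
  funext i; simp [latticeVec]

lemma isReflexive_hullOf_gVec : IsReflexive (hullOf (gVec k n)) := by
  refine ⟨isLatticePolytope_hullOf _, zero_mem_interior_hullOf_gVec hk hkn, ?_⟩
  obtain ⟨C, hC⟩ := polarDual_hullOf_gVec_bounded hk hkn
  refine isLatticePolytope_polarDual hC fun y hy => ?_
  obtain ⟨w, hw, hφw⟩ := (isFlowOrder_gridExt_add_cutSum hk hkn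
    (mem_polarDual_hullOf_gVec.1 hy)).gridRes_mem hk hkn
  have hy' : y = (n : ℝ) • w - latticeVec (gridRes k n (cutSum k (Finset.Icc 1 n))) := by
    rw [← hφw]
    funext p
    have := congrFun (gridRes_gridExt 0 y) p
    simp only [gridRes] at this
    simp [gridRes, latticeVec, this]
  rw [hy']
  refine smul_sub_mem_convexHull ?_ hw
  rintro _ ⟨χ, hχ, rfl⟩
  have h1 := card_smul_sub_cutSum_mem hk hkn (subset_refl (Finset.Icc 1 n)) hχ
  refine subset_convexHull ℝ _ ⟨(n : ℤ) • χ - gridRes k n (cutSum k (Finset.Icc 1 n)),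
    mem_polarDual_hullOf_gVec.2 fun ρ => ?_, ?_⟩
  · have h2 := h1 ρ
    rw [gMerged_Icc hk hkn, divisorOf, Set.indicator_univ, Pi.one_apply, Nat.card_Icc,
      Nat.add_sub_cancel] at h2
    rw [latticeVec_dotProduct]
    exact_mod_cast h2
  · rw [latticeVec_smul_sub]
    simp


end Delta

section Vertices

variable {k n : ℕ} (hk : 1 ≤ k) (hkn : k < n)
include hk hkn

/-! ### The vertices and faces of `Δ(k,n)` -/

/-- Each generator is the unique maximum on the generators of the pairing with itself. -/
lemma gVec_dotProduct_lt {ρ σ : GVertex k n} (h : σ ≠ ρ) :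
    gVec k n ρ ⬝ᵥ gVec k n σ < gVec k n ρ ⬝ᵥ gVec k n ρ := by
  obtain ⟨φ, hφ⟩ : ∃ φ : ℕ × ℕ → ℤ, φ = fun q =>
    (if (q.1 = ρ.head.1 ∧ q.2 = ρ.head.2) ∧ ¬ (q.1 = k ∧ q.2 = n - k + 1) then 1 else 0) -
    if (q.1 = ρ.tail.1 ∧ q.2 = ρ.tail.2) ∧ ¬ (q.1 = 1 ∧ q.2 = 0) then 1 else 0 := ⟨_, rfl⟩
  have hres : gVec k n ρ = gridRes k n φ := by
    funext ⟨⟨p, hp⟩, ⟨q, hq⟩⟩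
    cases ρ <;> simp only [gVec, fVec, gridRes, hφ, GVertex.head, GVertex.tail, Pi.sub_apply,
      Pi.neg_apply] <;> grind
  have h0 : φ (1, 0) = 0 := by
    cases ρ <;> simp only [hφ, GVertex.head, GVertex.tail] <;> grind
  have h1 : φ (k, n - k + 1) = 0 := by
    cases ρ <;> simp only [hφ, GVertex.head, GVertex.tail] <;> grind
  have hd : ∀ τ, gVec k n ρ ⬝ᵥ gVec k n τ = φ τ.head - φ τ.tail := fun τ => by
    rw [hres, gridRes_dotProduct_gVec_int hk hkn h0 h1]
  rw [hd, hd, hφ]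
  cases ρ <;> cases σ <;> simp only [GVertex.head, GVertex.tail, ne_eq, not_true_eq_false,
    GVertex.u.injEq, GVertex.v.injEq] at h ⊢ <;> grind

lemma gVec_injective : Function.Injective (gVec k n) := by
  intro ρ σ h
  by_contra hne
  have := gVec_dotProduct_lt hk hkn (Ne.symm hne)
  rw [h] at this
  exact lt_irrefl _ this

lemma range_gVec_eq_extremePoints :
    (Set.range fun ρ => latticeVec (gVec k n ρ)) = (hullOf (gVec k n)).extremePoints ℝ := by
  refine Set.Subset.antisymm ?_ extremePoints_convexHull_subset
  rintro _ ⟨ρ, rfl⟩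
  set c : ℝ := latticeVec (gVec k n ρ) ⬝ᵥ latticeVec (gVec k n ρ) with hc
  have hlt : ∀ σ, σ ≠ ρ → latticeVec (gVec k n ρ) ⬝ᵥ latticeVec (gVec k n σ) < c := by
    intro σ hσ
    rw [hc, latticeVec_dotProduct, latticeVec_dotProduct]
    exact_mod_cast gVec_dotProduct_lt hk hkn hσ
  have hle : ∀ x ∈ hullOf (gVec k n), latticeVec (gVec k n ρ) ⬝ᵥ x ≤ c := by
    intro x hx
    have := convexHull_min (t := {x | -c ≤ (-latticeVec (gVec k n ρ)) ⬝ᵥ x}) ?_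
      (convex_dotProduct_ge _ _) hx
    · rw [Set.mem_ofPred_eq, neg_dotProduct] at this
      linarith
    · rintro _ ⟨σ, rfl⟩
      rw [Set.mem_ofPred_eq, neg_dotProduct, neg_le_neg_iff]
      by_cases hσ : σ = ρ
      · rw [hσ]
      · exact (hlt σ hσ).le
  have heq : ∀ x ∈ hullOf (gVec k n), latticeVec (gVec k n ρ) ⬝ᵥ x = c →
      x = latticeVec (gVec k n ρ) := by
    intro x hx hxc
    rw [hullOf, convexHull_range_eq_exists_affineCombination] at hx
    obtain ⟨s, w, hw0, hw1, rfl⟩ := hx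
    rw [Finset.affineCombination_eq_linear_combination _ _ _ hw1] at hxc ⊢
    rw [dotProduct_sum] at hxc
    simp only [dotProduct_smul, smul_eq_mul] at hxc
    have h1 : ∑ σ ∈ s, w σ * (c - latticeVec (gVec k n ρ) ⬝ᵥ latticeVec (gVec k n σ)) = 0 := by
      simp only [mul_sub, Finset.sum_sub_distrib, ← Finset.sum_mul, hw1, hxc]
      ring
    have h2 := (Finset.sum_eq_zero_iff_of_nonneg fun σ hσ => mul_nonneg (hw0 σ hσ) (by
      by_cases h' : σ = ρ
      · rw [h', hc, sub_self]
      · linarith [hlt σ h'])).1 h1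
    have h3 : ∀ σ ∈ s, w σ • latticeVec (gVec k n σ) = w σ • latticeVec (gVec k n ρ) := by
      intro σ hσ
      rcases mul_eq_zero.1 (h2 σ hσ) with h | h
      · rw [h, zero_smul, zero_smul]
      · by_cases h' : σ = ρ
        · rw [h']
        · linarith [hlt σ h']
    rw [Finset.sum_congr rfl h3, ← Finset.sum_smul, hw1, one_smul]
  refine mem_extremePoints_iff_left.2 ⟨latticeVec_mem_hullOf _ ρ, fun x hx y hy hxy => ?_⟩
  obtain ⟨a, b, ha, hb, hab, hz⟩ := hxy
  apply heq x hx
  have h1 : a * (latticeVec (gVec k n ρ) ⬝ᵥ x) + b * (latticeVec (gVec k n ρ) ⬝ᵥ y) = c := by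
    have := congrArg (fun v => latticeVec (gVec k n ρ) ⬝ᵥ v) hz
    simpa only [dotProduct_add, dotProduct_smul, smul_eq_mul] using this
  have h2 := hle x hx
  have h3 := hle y hy
  refine le_antisymm h2 ?_
  by_contra hcon
  have h4 := mul_lt_mul_of_pos_left (not_le.1 hcon) ha
  have h5 := mul_le_mul_of_nonneg_left h3 hb.le
  have h6 : a * c + b * c = c := by rw [← add_mul, hab, one_mul]
  linarith

/-- The proper faces of `Δ(k,n)` are given by increasing functions on the network from `0` to `n`:
the vertices on the face are the edges along which the function is constant. -/
lemma IsProperFace.exists_isFlowOrder {F : Set (Fin k × Fin (n - k) → ℝ)}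
    (hF : IsProperFace (hullOf (gVec k n)) F) :
    ∃ φ : ℕ × ℕ → ℝ, IsFlowOrder k n (n : ℝ) φ ∧
      ∀ ρ, latticeVec (gVec k n ρ) ∈ F ↔ φ ρ.tail = φ ρ.head := by
  obtain ⟨y, hy, hyF⟩ := hF.exists_functional (zero_mem_interior_hullOf_gVec hk hkn)
  refine ⟨_, isFlowOrder_gridExt_add_cutSum hk hkn hy, fun ρ => ?_⟩
  rw [hyF, and_iff_right (latticeVec_mem_hullOf _ ρ), dotProduct_latticeVec_gVec hk hkn]
  have := cutSum_Icc_sub hk hkn ρ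
  have h' : (cutSum k (Finset.Icc 1 n) ρ.head : ℝ) - cutSum k (Finset.Icc 1 n) ρ.tail = 1 := by
    exact_mod_cast this
  constructor <;> intro h <;> linarith

lemma IsFlowOrder.exists_isProperFace {φ : ℕ × ℕ → ℝ} (hφ : IsFlowOrder k n (n : ℝ) φ) :
    ∃ F, IsProperFace (hullOf (gVec k n)) F ∧
      ∀ ρ, latticeVec (gVec k n ρ) ∈ F ↔ φ ρ.tail = φ ρ.head := by
  set y : Fin k × Fin (n - k) → ℝ :=
    gridRes k n fun q => φ q - cutSum k (Finset.Icc 1 n) q with hy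
  have hd : ∀ ρ, y ⬝ᵥ latticeVec (gVec k n ρ) = φ ρ.head - φ ρ.tail - 1 := by
    intro ρ
    have h' : (cutSum k (Finset.Icc 1 n) ρ.head : ℝ) - cutSum k (Finset.Icc 1 n) ρ.tail = 1 := by
      exact_mod_cast cutSum_Icc_sub hk hkn ρ
    have := gridRes_dotProduct_gVec hk hkn (φ := fun q => φ q - cutSum k (Finset.Icc 1 n) q)
      (by simp [hφ.source, cutSum_source]) (by simp [hφ.sink, cutSum_Icc_sink hkn]) ρ
    refine this.trans ?_
    linarith
  refine ⟨_, isProperFace_of_functional (zero_mem_interior_hullOf_gVec hk hkn) (y := y)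
    fun ρ => ?_, fun ρ => ?_⟩
  · rw [hd]
    linarith [hφ.mono ρ]
  · change _ ∧ _ ↔ _
    rw [and_iff_right (latticeVec_mem_hullOf _ ρ), hd]
    constructor <;> intro h <;> linarith

/-! ### The divisors of unions of groups -/

/-- Rounding down `φ / n` preserves all weak inequalities and equalities along edges; so every face
lies in one that is given by an up-set of the grid. -/
lemma IsProperFace.exists_orderPoint {F : Set (Fin k × Fin (n - k) → ℝ)}
    (hF : IsProperFace (hullOf (gVec k n)) F) :
    ∃ ψ : ℕ × ℕ → ℤ, IsFlowOrder k n (1 : ℤ) ψ ∧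
      ∀ ρ, latticeVec (gVec k n ρ) ∈ F → ψ ρ.tail = ψ ρ.head := by
  obtain ⟨φ, hφ, hF'⟩ := hF.exists_isFlowOrder hk hkn
  have hn : (0 : ℝ) < n := by exact_mod_cast (by omega : 0 < n)
  refine ⟨fun q => ⌊φ q / n⌋, ⟨by simp [hφ.source], ?_, fun ρ => ?_⟩, fun ρ hρ => ?_⟩
  · simp only [hφ.sink, div_self hn.ne', Int.floor_one]
  · exact Int.floor_le_floor (by have := hφ.mono ρ; gcongr)
  · simp only [(hF' ρ).1 hρ]

/-- On every chart the divisor of a union of groups has a monomial global section as a local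
generator. -/
lemma exists_sectionExponent {A : Finset ℕ} (hA : A ⊆ Finset.Icc 1 n)
    {F : Set (Fin k × Fin (n - k) → ℝ)} (hF : IsProperFace (hullOf (gVec k n)) F) :
    ∃ m ∈ sectionExponents (gVec k n) (divisorOf (gMerged k n A)),
      ∀ ρ, latticeVec (gVec k n ρ) ∈ F → m ⬝ᵥ gVec k n ρ = -divisorOf (gMerged k n A) ρ := by
  obtain ⟨ψ, hψ, hF'⟩ := hF.exists_orderPoint hk hkn
  refine ⟨_, card_smul_sub_cutSum_mem hk hkn hA ⟨ψ, hψ, rfl⟩, fun ρ hρ => ?_⟩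
  rw [card_smul_sub_cutSum_dotProduct hk hkn hA hψ, hF' ρ hρ]
  ring

lemma isCartier_divisorOf_gMerged {A : Finset ℕ} (hA : A ⊆ Finset.Icc 1 n) :
    IsCartier (gVec k n) (divisorOf (gMerged k n A)) :=
  isCartier_of_exponents (zero_mem_interior_hullOf_gVec hk hkn) fun _ hF =>
    let ⟨m, _, hm⟩ := exists_sectionExponent hk hkn hA hF
    ⟨m, hm⟩

lemma isSemiample_divisorOf_gMerged {A : Finset ℕ} (hA : A ⊆ Finset.Icc 1 n) :
    IsSemiample (gVec k n) (divisorOf (gMerged k n A)) :=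
  ⟨1, one_pos, by
    rw [one_smul]
    exact isGloballyGenerated_of_exponents (zero_mem_interior_hullOf_gVec hk hkn)
      fun _ hF => exists_sectionExponent hk hkn hA hF⟩

/-- For a face given by a real function `φ`, rounding down a large multiple `N • φ` gives an
integral function that is constant along exactly the same edges. -/
lemma IsProperFace.exists_int_isFlowOrder {F : Set (Fin k × Fin (n - k) → ℝ)}
    (hF : IsProperFace (hullOf (gVec k n)) F) :
    ∃ N : ℕ, 0 < N ∧ ∃ ζ : ℕ × ℕ → ℤ, IsFlowOrder k n (N * n : ℤ) ζ ∧
      ∀ ρ, latticeVec (gVec k n ρ) ∈ F ↔ ζ ρ.tail = ζ ρ.head := by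
  have := Fintype.ofFinite (GVertex k n)
  obtain ⟨φ, hφ, hF'⟩ := hF.exists_isFlowOrder hk hkn
  obtain ⟨N, hN⟩ : ∃ N : ℕ, ∀ ρ : GVertex k n, (φ ρ.head - φ ρ.tail)⁻¹ ≤ N := by
    obtain ⟨N, hN⟩ := exists_nat_ge (∑ ρ : GVertex k n, (φ ρ.head - φ ρ.tail)⁻¹)
    refine ⟨N, fun ρ => le_trans ?_ hN⟩
    exact Finset.single_le_sum (f := fun ρ : GVertex k n => (φ ρ.head - φ ρ.tail)⁻¹)
      (fun ρ _ => inv_nonneg.2 (sub_nonneg.2 (hφ.mono ρ))) (Finset.mem_univ ρ)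
  have hmono : ∀ ρ : GVertex k n, ⌊((N + 1 : ℕ) : ℝ) * φ ρ.tail⌋ ≤ ⌊((N + 1 : ℕ) : ℝ) * φ ρ.head⌋ :=
    fun ρ => Int.floor_le_floor (by have := hφ.mono ρ; gcongr)
  refine ⟨N + 1, N.succ_pos, fun q => ⌊((N + 1 : ℕ) : ℝ) * φ q⌋,
    ⟨by simp [hφ.source], ?_, hmono⟩, fun ρ => ⟨fun hρ => ?_, fun hρ => ?_⟩⟩
  · have : (((N + 1 : ℕ) : ℝ) * n) = (((N + 1 : ℕ) * n : ℤ) : ℝ) := by push_cast; ring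
    simp only [hφ.sink]
    rw [this, Int.floor_intCast]
  · simp only [(hF' ρ).1 hρ]
  · rw [hF']
    by_contra hne
    have hpos : 0 < φ ρ.head - φ ρ.tail :=
      sub_pos.2 (lt_of_le_of_ne (hφ.mono ρ) hne)
    have h1 : 1 ≤ (N : ℝ) * (φ ρ.head - φ ρ.tail) := by
      have := mul_le_mul_of_nonneg_right (hN ρ) hpos.le
      rwa [inv_mul_cancel₀ hpos.ne'] at this
    have h2 : ((N + 1 : ℕ) : ℝ) * φ ρ.tail + 1 ≤ ((N + 1 : ℕ) : ℝ) * φ ρ.head := by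
      push_cast
      linarith
    have h3 := Int.floor_le_floor h2
    rw [Int.floor_add_one] at h3
    dsimp only at hρ
    omega

lemma isAmple_divisorOf_gE {l : ℕ} (hl : l ∈ Finset.Icc 1 n) :
    IsAmple (gVec k n) (divisorOf (gE k n l)) := by
  refine isAmple_of_exponents (zero_mem_interior_hullOf_gVec hk hkn) fun F hF => ?_
  obtain ⟨N, hN, ζ, hζ, hF'⟩ := hF.exists_int_isFlowOrder hk hkn
  refine ⟨N * n, Nat.mul_pos hN (by omega),
    gridRes k n fun q => ζ q - (N * n : ℤ) * cutSum k {l} q, fun ρ => ?_⟩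
  have hA : ({l} : Finset ℕ) ⊆ Finset.Icc 1 n := Finset.singleton_subset_iff.2 hl
  rw [gridRes_dotProduct_gVec_int hk hkn (by simp [hζ.source, cutSum_source])
    (by simp [hζ.sink, cutSum_sink hkn hA]), hF', ← gMerged_singleton, ← cutSum_sub hk hkn hA]
  have := hζ.mono ρ
  push_cast
  constructor
  · linarith
  · constructor <;> intro h <;> linarith

/-- The face of all vertices but `u_{1,0}` makes every torus invariant Cartier divisor linearly
equivalent to a multiple of `D_{u_{1,0}}`, which is `D(E_1)`; and the `D(E_l)` differ by divisors
of characters. -/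
lemma IsCartier.exists_linEquivalent {b : GVertex k n → ℤ} (hb : IsCartier (gVec k n) b) {l : ℕ}
    (hl : l ∈ Finset.Icc 1 n) :
    ∃ c : ℤ, LinEquivalent (gVec k n) b (c • divisorOf (gE k n l)) := by
  classical
  have h1 : 1 ∈ Finset.Icc 1 n := Finset.mem_Icc.2 ⟨le_rfl, by omega⟩
  have hA : ∀ {l}, l ∈ Finset.Icc 1 n → ({l} : Finset ℕ) ⊆ Finset.Icc 1 n :=
    fun h => Finset.singleton_subset_iff.2 h
  have hfirst : ∀ ρ : GVertex k n, ρ ≠ .uFirst → ρ.tail ≠ (1, 0) := by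
    intro ρ h
    cases ρ <;> simp [GVertex.tail] at h ⊢ <;> omega
  have hhead : ∀ ρ : GVertex k n, ρ.head ≠ (1, 0) := by
    intro ρ
    cases ρ <;> simp [GVertex.head]
  have hφ : IsFlowOrder k n (n : ℝ) (fun q => if q = (1, 0) then 0 else n) := by
    refine ⟨by simp, by simp, fun ρ => ?_⟩
    rw [if_neg (hhead ρ)]
    split_ifs <;> simp
  obtain ⟨F, hF, hF'⟩ := hφ.exists_isProperFace hk hkn
  obtain ⟨m, hm⟩ := hb.exists_exponent hF
  have hm' : ∀ ρ : GVertex k n, ρ ≠ .uFirst → m ⬝ᵥ gVec k n ρ = -b ρ := fun ρ hρ =>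
    hm ρ ((hF' ρ).2 (by simp [hfirst ρ hρ, hhead ρ]))
  refine ⟨b .uFirst + m ⬝ᵥ gVec k n .uFirst,
    (b .uFirst + m ⬝ᵥ gVec k n .uFirst) •
      gridRes k n (fun q => cutSum k {1} q - cutSum k {l} q) - m, fun ρ => ?_⟩
  rw [sub_dotProduct, smul_dotProduct, gridRes_dotProduct_gVec_int hk hkn
    (by simp [cutSum_source]) (by simp [cutSum_sink hkn (hA hl), cutSum_sink hkn (hA h1)]),
    Pi.smul_apply, smul_eq_mul, smul_eq_mul, ← gMerged_singleton, ← cutSum_sub hk hkn (hA hl)]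
  have hE : cutSum k {1} ρ.head - cutSum k {1} ρ.tail = if ρ = .uFirst then 1 else 0 := by
    rw [cutSum, cutSum, Finset.sum_singleton, Finset.sum_singleton, gridCut_sub hk hkn h1]
    have : gGroup k n ρ = 1 ↔ ρ = .uFirst := by
      cases ρ <;> simp [gGroup] <;> omega
    simp [this]
  by_cases hρ : ρ = .uFirst
  · subst hρ
    rw [if_pos rfl] at hE
    linear_combination -(b .uFirst + m ⬝ᵥ gVec k n .uFirst) * hE
  · rw [if_neg hρ] at hE
    rw [hm' ρ hρ]
    linear_combination -(b .uFirst + m ⬝ᵥ gVec k n .uFirst) * hE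

lemma isAmpleGenerator_divisorOf_gE {l : ℕ} (hl : l ∈ Finset.Icc 1 n) :
    IsAmpleGenerator (gVec k n) (divisorOf (gE k n l)) := by
  refine ⟨?_, isAmple_divisorOf_gE hk hkn hl,
    fun b hb => hb.exists_linEquivalent hk hkn hl⟩
  rw [← gMerged_singleton]
  exact isCartier_divisorOf_gMerged hk hkn (Finset.singleton_subset_iff.2 hl)

lemma isNefPartition_gMerged {r : ℕ} {J : Fin r → Finset ℕ}
    (hdisj : Pairwise fun i i' => Disjoint (J i) (J i'))
    (hunion : (Finset.univ.biUnion J) = Finset.Icc 1 n) :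
    IsNefPartition (gVec k n) (fun i => gMerged k n (J i)) := by
  have hJ : ∀ i, J i ⊆ Finset.Icc 1 n := fun i =>
    hunion ▸ Finset.subset_biUnion_of_mem J (Finset.mem_univ i)
  have hmem : ∀ (A : Finset ℕ) (ρ : GVertex k n), ρ ∈ gMerged k n A ↔ gGroup k n ρ ∈ A := by
    intro A ρ; simp [gMerged, gE]
  refine ⟨isReflexive_hullOf_gVec hk hkn, gVec_injective hk hkn,
    range_gVec_eq_extremePoints hk hkn, fun i i' h => ?_, ?_, fun i =>
    ⟨isCartier_divisorOf_gMerged hk hkn (hJ i), isSemiample_divisorOf_gMerged hk hkn (hJ i)⟩⟩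
  · refine Set.disjoint_left.2 fun ρ h1 h2 => ?_
    exact Finset.disjoint_left.1 (hdisj h) ((hmem _ _).1 h1) ((hmem _ _).1 h2)
  · refine Set.eq_univ_of_forall fun ρ => ?_
    have h1 := gGroup_mem hk hkn ρ
    rw [← hunion, Finset.mem_biUnion] at h1
    obtain ⟨i, _, hi⟩ := h1
    exact Set.mem_iUnion.2 ⟨i, (hmem _ _).2 hi⟩

end Vertices

/-! ### Reflexivity of the dual Minkowski sum -/

section Nabla

open scoped Pointwise in
lemma minkowskiSum_eq_sum {ι : Type*} {r : ℕ} (Q : Fin r → Set (ι → ℝ)) :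
    minkowskiSum Q = ∑ i, Q i := by
  ext x
  rw [Set.mem_fintype_sum]
  exact ⟨fun ⟨y, hy, h⟩ => ⟨y, hy, h.symm⟩, fun ⟨y, hy, h⟩ => ⟨y, hy, h.symm⟩⟩

lemma nablaOf_eq {ι I : Type*} (e : I → ι → ℤ) (A : Set I) :
    nablaOf e A = convexHull ℝ (latticeVec '' insert 0 (e '' A)) := by
  have h0 : latticeVec (0 : ι → ℤ) = 0 := by funext p; simp [latticeVec]
  rw [Set.image_insert_eq, h0, Set.image_image, nablaOf]

open scoped Pointwise in
lemma isLatticePolytope_minkowskiSum_nablaOf {ι I : Type*} [Finite I] {r : ℕ} (e : I → ι → ℤ)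
    (parts : Fin r → Set I) : IsLatticePolytope (minkowskiSum fun i => nablaOf e (parts i)) := by
  classical
  have hfin : ∀ i, (insert 0 (e '' parts i)).Finite := fun i => (Set.toFinite _).insert 0
  refine ⟨(Fintype.piFinset fun i => (hfin i).toFinset).image fun x => ∑ i, x i, ?_⟩
  simp only [nablaOf_eq]
  rw [minkowskiSum_eq_sum, ← convexHull_sum]
  congr 1
  ext x
  rw [Set.mem_fintype_sum]
  constructor
  · rintro ⟨g, hg, rfl⟩
    choose h hh hh' using hg
    refine ⟨∑ i, h i, ?_, ?_⟩
    · rw [Finset.mem_coe, Finset.mem_image]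
      exact ⟨h, Fintype.mem_piFinset.2 fun i => (hfin i).mem_toFinset.2 (hh i), rfl⟩
    · rw [latticeVec_sum]
      exact Finset.sum_congr rfl fun i _ => hh' i
  · rintro ⟨m, hm, rfl⟩
    rw [Finset.mem_coe, Finset.mem_image] at hm
    obtain ⟨h, hh, rfl⟩ := hm
    refine ⟨fun i => latticeVec (h i), fun i => ⟨h i, ?_, rfl⟩, (latticeVec_sum _ _).symm⟩
    exact (hfin i).mem_toFinset.1 (Fintype.mem_piFinset.1 hh i)

lemma zero_mem_nablaOf {ι I : Type*} (e : I → ι → ℤ) (A : Set I) : 0 ∈ nablaOf e A :=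
  subset_convexHull ℝ _ (Set.mem_insert _ _)

lemma latticeVec_mem_nablaOf {ι I : Type*} (e : I → ι → ℤ) {A : Set I} {j : I} (hj : j ∈ A) :
    latticeVec (e j) ∈ nablaOf e A :=
  subset_convexHull ℝ _ (Set.mem_insert_of_mem _ ⟨j, hj, rfl⟩)

open scoped Pointwise in
lemma hullOf_subset_minkowskiSum {ι I : Type*} (e : I → ι → ℤ) {r : ℕ} {parts : Fin r → Set I}
    (hcov : (⋃ i, parts i) = Set.univ) :
    hullOf e ⊆ minkowskiSum fun i => nablaOf e (parts i) := by
  classical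
  refine convexHull_min ?_ ?_
  · rintro _ ⟨j, rfl⟩
    obtain ⟨i, hi⟩ := Set.mem_iUnion.1 (hcov.symm ▸ Set.mem_univ j : j ∈ ⋃ i, parts i)
    refine ⟨Pi.single i (latticeVec (e j)), fun i' => ?_, by simp⟩
    by_cases h : i' = i
    · subst h
      simpa using latticeVec_mem_nablaOf e hi
    · rw [Pi.single_eq_of_ne h]
      exact zero_mem_nablaOf e _
  · simp only [nablaOf]
    rw [minkowskiSum_eq_sum, ← convexHull_sum]
    exact convex_convexHull ℝ _

/-- A section of the divisor of the `i`-th part is in the polar dual of the Minkowski sum: it is at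
least `-1` on the `i`-th summand and at least `0` on the others. -/
lemma latticeVec_mem_polarDual_minkowskiSum {ι I : Type*} [Fintype ι] {e : I → ι → ℤ} {r : ℕ}
    {parts : Fin r → Set I} (hdisj : Pairwise fun i i' => Disjoint (parts i) (parts i')) {i : Fin r}
    {m : ι → ℤ} (hm : m ∈ sectionExponents e (divisorOf (parts i))) :
    latticeVec m ∈ polarDual (minkowskiSum fun i => nablaOf e (parts i)) := by
  classical
  rintro _ ⟨x, hx, rfl⟩
  have key : ∀ i', (if i' = i then (-1 : ℝ) else 0) ≤ latticeVec m ⬝ᵥ x i' := by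
    intro i'
    refine convexHull_min (t := {x | (if i' = i then (-1 : ℝ) else 0) ≤ latticeVec m ⬝ᵥ x}) ?_
      (convex_dotProduct_ge _ _) (hx i')
    rintro _ (rfl | ⟨j, hj, rfl⟩)
    · rw [Set.mem_ofPred_eq, dotProduct_zero]
      split_ifs <;> norm_num
    · have h1 := hm j
      rw [Set.mem_ofPred_eq, latticeVec_dotProduct]
      by_cases hi : i' = i
      · subst hi
        rw [divisorOf, Set.indicator_of_mem hj] at h1
        rw [if_pos rfl]
        exact_mod_cast h1
      · rw [divisorOf, Set.indicator_of_notMem (Set.disjoint_left.1 (hdisj hi) hj)] at h1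
        rw [if_neg hi]
        exact_mod_cast h1
  have := Finset.sum_le_sum fun i' (_ : i' ∈ Finset.univ) => key i'
  rw [dotProduct_sum]
  simpa using this

variable {k n : ℕ} (hk : 1 ≤ k) (hkn : k < n)
include hk hkn

/-- The dual Minkowski sum is reflexive. A vector `y` of its polar dual satisfies `y ≥ -λ_i` on the
`i`-th part with `λ_i ≥ 0` and `∑ λ_i ≤ 1`; adding the corresponding combination of cuts makes it an
increasing function, which is a multiple of a point `w` of the order polytope, and `y` is the
combination with coefficients `λ_i` of the points `|J_i| w - cutSum (J_i)` and of `0`. -/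
lemma isReflexive_minkowskiSum_nablaOf {r : ℕ} {J : Fin r → Finset ℕ}
    (hdisj : Pairwise fun i i' => Disjoint (J i) (J i'))
    (hunion : (Finset.univ.biUnion J) = Finset.Icc 1 n) :
    IsReflexive (minkowskiSum fun i => nablaOf (gVec k n) (gMerged k n (J i))) := by
  classical
  have hnef := isNefPartition_gMerged hk hkn hdisj hunion
  have hJ : ∀ i, J i ⊆ Finset.Icc 1 n := fun i =>
    hunion ▸ Finset.subset_biUnion_of_mem J (Finset.mem_univ i)
  have hpd : Pairwise fun i i' => Disjoint (gMerged k n (J i)) (gMerged k n (J i')) :=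
    hnef.2.2.2.1
  have hcov : (⋃ i, gMerged k n (J i)) = Set.univ := hnef.2.2.2.2.1
  have hsub := hullOf_subset_minkowskiSum (gVec k n) hcov
  obtain ⟨C, hC⟩ := polarDual_hullOf_gVec_bounded hk hkn
  refine ⟨isLatticePolytope_minkowskiSum_nablaOf _ _,
    interior_mono hsub (zero_mem_interior_hullOf_gVec hk hkn),
    isLatticePolytope_polarDual (fun y hy => hC y fun x hx => hy x (hsub hx)) fun y hy => ?_⟩
  set S := latticeVec '' latticePoints
    (polarDual (minkowskiSum fun i => nablaOf (gVec k n) (gMerged k n (J i)))) with hS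
  have hmin : ∀ i, ∃ x ∈ nablaOf (gVec k n) (gMerged k n (J i)),
      ∀ x' ∈ nablaOf (gVec k n) (gMerged k n (J i)), y ⬝ᵥ x ≤ y ⬝ᵥ x' := by
    intro i
    have hcomp : IsCompact (nablaOf (gVec k n) (gMerged k n (J i))) := by
      rw [nablaOf]
      exact (((Set.toFinite _).image _).insert 0).isCompact_convexHull ℝ
    exact hcomp.exists_isMinOn ⟨0, zero_mem_nablaOf _ _⟩
      (f := fun x => y ⬝ᵥ x) (by unfold dotProduct; fun_prop)
  choose x hx hxmin using hmin
  set lam : Fin r → ℝ := fun i => -(y ⬝ᵥ x i) with hlam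
  have hlam0 : ∀ i, 0 ≤ lam i := fun i => by
    have := hxmin i 0 (zero_mem_nablaOf _ _)
    rw [dotProduct_zero] at this
    simpa [hlam] using this
  have hlam1 : ∑ i, lam i ≤ 1 := by
    have := hy (∑ i, x i) ⟨x, hx, rfl⟩
    rw [dotProduct_sum] at this
    simp only [hlam, Finset.sum_neg_distrib]
    linarith
  set κ : ℕ × ℕ → ℝ := fun q => ∑ i, lam i * cutSum k (J i) q with hκ
  have hκd : ∀ ρ : GVertex k n, κ ρ.head - κ ρ.tail =
      ∑ i, lam i * divisorOf (gMerged k n (J i)) ρ := by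
    intro ρ
    simp only [hκ, ← Finset.sum_sub_distrib, ← mul_sub]
    refine Finset.sum_congr rfl fun i _ => ?_
    rw [← cutSum_sub hk hkn (hJ i)]
    push_cast
    rfl
  obtain ⟨w, hw, hφw⟩ := (isFlowOrder_gridExt_add hk hkn (κ := κ)
    (c := ∑ i, lam i * (J i).card) (by simp [hκ, cutSum_source])
    (by simp only [hκ, cutSum_sink hkn (hJ _), Int.cast_natCast]) (y := y) fun ρ => by
      obtain ⟨i, hi⟩ := Set.mem_iUnion.1 (hcov.symm ▸ Set.mem_univ ρ : ρ ∈ ⋃ i, gMerged k n (J i))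
      rw [hκd, Finset.sum_eq_single i]
      · rw [divisorOf, Set.indicator_of_mem hi]
        have := hxmin i _ (latticeVec_mem_nablaOf (gVec k n) hi)
        simpa [hlam] using this
      · intro i' _ hne
        rw [divisorOf, Set.indicator_of_notMem (Set.disjoint_left.1 (hpd hne.symm) hi)]
        simp
      · simp).gridRes_mem hk hkn
  have hz : ∀ i, ((J i).card : ℝ) • w - latticeVec (gridRes k n (cutSum k (J i))) ∈
      convexHull ℝ S := by
    intro i
    refine smul_sub_mem_convexHull ?_ hw
    rintro _ ⟨χ, hχ, rfl⟩
    refine subset_convexHull ℝ _ ⟨((J i).card : ℤ) • χ - gridRes k n (cutSum k (J i)),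
      latticeVec_mem_polarDual_minkowskiSum hpd (card_smul_sub_cutSum_mem hk hkn (hJ i) hχ), ?_⟩
    rw [latticeVec_smul_sub]
    simp
  have h0S : (0 : Fin k × Fin (n - k) → ℝ) ∈ convexHull ℝ S := by
    have h0 : latticeVec (0 : Fin k × Fin (n - k) → ℤ) = 0 := by funext p; simp [latticeVec]
    refine subset_convexHull ℝ _ ⟨0, ?_, h0⟩
    change latticeVec 0 ∈ polarDual _
    rw [h0]
    intro x _
    simp
  have hy' : y = ∑ i, lam i • (((J i).card : ℝ) • w -
      latticeVec (gridRes k n (cutSum k (J i)))) := by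
    have h1 : y = (∑ i, lam i * (J i).card) • w -
        ∑ i, lam i • latticeVec (gridRes k n (cutSum k (J i))) := by
      rw [← hφw]
      funext p
      have := congrFun (gridRes_gridExt 0 y) p
      simp only [gridRes] at this
      simp [gridRes, latticeVec, this, hκ]
    rw [h1, Finset.sum_smul, ← Finset.sum_sub_distrib]
    refine Finset.sum_congr rfl fun i _ => ?_
    rw [smul_sub, smul_smul]
  have := (convex_convexHull ℝ S).sum_mem (t := Finset.univ)
    (w := fun o : Option (Fin r) => o.elim (1 - ∑ i, lam i) lam)
    (z := fun o => o.elim 0 fun i => ((J i).card : ℝ) • w -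
      latticeVec (gridRes k n (cutSum k (J i))))
    (fun o _ => by
      cases o
      · simpa using hlam1
      · exact hlam0 _)
    (by simp [Fintype.sum_option]) (fun o _ => by
      cases o
      · exact h0S
      · exact hz _)
  rw [Fintype.sum_option] at this
  rw [hy']
  simpa using this

end Nabla

/-! ### Hypersurface sections and generic Laurent polynomials -/

section HypersurfaceSections

variable {ι I : Type*} [Fintype ι] {e : I → ι → ℤ}

lemma mem_latticePoints_sectionPolytope {A : Set I} {m : ι → ℤ} :
    m ∈ latticePoints (sectionPolytope e A) ↔ m ∈ sectionExponents e (divisorOf A) := by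
  change (∀ j, _) ↔ ∀ j, _
  refine forall_congr' fun j => ?_
  rw [latticeVec_dotProduct]
  exact_mod_cast Iff.rfl

/-- The exponent of the Laurent monomial to which a monomial in the homogeneous coordinates
restricts. -/
def restrictExponent {H : I → ℤ} (α : sectionExponents e H →₀ ℕ) : ι → ℤ :=
  α.sum fun m c => c • (m : ι → ℤ)

lemma restrictForm_monomial {H : I → ℤ} (α : sectionExponents e H →₀ ℕ) (c : ℂ) :
    restrictForm e H (MvPolynomial.monomial α c) =
      AddMonoidAlgebra.single (restrictExponent α) c := by
  have h : ∀ s : Finset (sectionExponents e H),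
      ∏ m ∈ s, character (m : ι → ℤ) ^ α m = character (∑ m ∈ s, α m • (m : ι → ℤ)) := by
    classical
    intro s
    induction s using Finset.induction_on with
    | empty => rfl
    | insert a s ha ih =>
      rw [Finset.prod_insert ha, Finset.sum_insert ha, ih, ← character_mul_character]
      congr 1
      simp [character, AddMonoidAlgebra.single_pow]
  rw [restrictForm, MvPolynomial.aeval_monomial, Finsupp.prod, h, restrictExponent, Finsupp.sum,
    AddMonoidAlgebra.coe_algebraMap]
  simp [character]

lemma le_restrictExponent_dotProduct {H : I → ℤ} {d : ℕ} (α : DegreeMonomial e H d) (j : I) :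
    -(d * H j) ≤ restrictExponent α.1 ⬝ᵥ e j := by
  have h1 : restrictExponent α.1 ⬝ᵥ e j =
      ∑ m ∈ α.1.support, α.1 m * ((m : ι → ℤ) ⬝ᵥ e j) := by
    rw [restrictExponent, Finsupp.sum, sum_dotProduct]
    exact Finset.sum_congr rfl fun m _ => by rw [smul_dotProduct, nsmul_eq_mul]
  have h2 : (d : ℤ) = ∑ m ∈ α.1.support, (α.1 m : ℤ) := by
    conv_lhs => rw [← α.2]
    exact Nat.cast_sum _ _
  rw [h1, h2, Finset.sum_mul, ← Finset.sum_neg_distrib]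
  refine Finset.sum_le_sum fun m _ => ?_
  rw [← mul_neg]
  exact mul_le_mul_of_nonneg_left (m.2 j) (Int.natCast_nonneg _)

lemma finite_degreeMonomial {H : I → ℤ} (hfin : (sectionExponents e H).Finite) (d : ℕ) :
    Finite (DegreeMonomial e H d) := by
  have := hfin.to_subtype
  refine Finite.of_injective
    (fun (α : DegreeMonomial e H d) (m : sectionExponents e H) =>
      (⟨α.1 m, Nat.lt_succ_of_le ((Finsupp.le_degree m α.1).trans α.2.le)⟩ : Fin (d + 1))) ?_
  intro α β h
  apply Subtype.ext
  ext m
  simpa using congrFun h m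

omit [Fintype ι] in
lemma coeff_laurentOf {Q : Set (ι → ℝ)} [Finite (latticePoints Q)] (c : latticePoints Q → ℂ)
    (m : latticePoints Q) : (laurentOf Q c).coeff m = c m := by
  classical
  have := Fintype.ofFinite (latticePoints Q)
  rw [laurentOf, finsum_eq_sum_of_fintype, AddMonoidAlgebra.coeff_sum, Finset.sum_apply',
    Finset.sum_eq_single m]
  · simp
  · intro m' _ hne
    have : (m' : ι → ℤ) ≠ m := fun h => hne (Subtype.ext h)
    simp [this]
  · simp

omit [Fintype ι] in
lemma coeff_laurentOf_of_notMem {Q : Set (ι → ℝ)} [Finite (latticePoints Q)]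
    (c : latticePoints Q → ℂ) {m : ι → ℤ} (hm : m ∉ latticePoints Q) :
    (laurentOf Q c).coeff m = 0 := by
  classical
  have := Fintype.ofFinite (latticePoints Q)
  rw [laurentOf, finsum_eq_sum_of_fintype, AddMonoidAlgebra.coeff_sum, Finset.sum_apply']
  refine Finset.sum_eq_zero fun m' _ => ?_
  have : (m' : ι → ℤ) ≠ m := fun h => hm (h ▸ m'.2)
  simp [this]

/-- If the sections of `O(d H)` and the Laurent polynomials `g i` correspond under multiplication
by characters, and `g i` has order exactly `-a i j` along every `D_j`, then the closures of the
hypersurfaces `g i = 0` have the same ideals as the zero schemes of the sections. -/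
lemma hypersurfaceIntersection_eq_compactified (h0 : (0 : ι → ℝ) ∈ interior (hullOf e))
    {H : I → ℤ} {r : ℕ} {d : Fin r → ℕ} {a : Fin r → I → ℤ} {μ : Fin r → ι → ℤ}
    (hμ : ∀ i j, d i * H j - a i j = μ i ⬝ᵥ e j)
    {f : Fin r → MvPolynomial (sectionExponents e H) ℂ} {g : Fin r → Laurent ι}
    (hg : ∀ i, g i = character (μ i) * restrictForm e H (f i))
    (hsec : ∀ i, g i ∈ globalSections e (a i))
    (hexact : ∀ i j, ∃ m, (g i).coeff m ≠ 0 ∧ m ⬝ᵥ e j = -a i j) :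
    hypersurfaceIntersection e H d f = compactified (hullOf e) g := by
  have hshift : ∀ (F : Set (ι → ℝ)) i (q : Laurent ι),
      character (μ i) * q ∈ localSections e F (-(d i • H)) ↔ q ∈ localSections e F (-a i) :=
    fun F i q => character_mul_mem_localSections fun j _ => by
      rw [← hμ i j]
      change -a i j - -(d i • H j) = _
      rw [nsmul_eq_mul]
      ring
  funext F
  apply le_antisymm
  · refine Ideal.span_le.2 ?_
    rintro x ⟨i, b, hb, hx⟩
    refine Ideal.mem_iSup_of_mem i ?_
    rw [Ideal.mem_comap, Ideal.mem_span_singleton']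
    refine ⟨character (-μ i) * b, ?_⟩
    change _ = (x : Laurent ι)
    rw [hx, hg i]
    conv_rhs => rw [← character_neg_mul_cancel (μ i) b]
    ring
  · refine iSup_le fun i x hx => ?_
    rw [Ideal.mem_comap, Ideal.mem_span_singleton'] at hx
    obtain ⟨q, hq⟩ := hx
    replace hq : q * g i = (x : Laurent ι) := hq
    have hmem : g i * q ∈ localSections e F.1 0 := by
      rw [mul_comm, hq, ← mem_chartRing h0 F.2]
      exact x.2
    have hq' := mem_localSections_of_mul (globalSections_le_localSections F.1 (a i) (hsec i))
      (fun j _ => hexact i j) hmem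
    refine Ideal.subset_span ⟨i, character (μ i) * q, (hshift F.1 i q).2 hq', ?_⟩
    rw [← hq, hg i]
    ring

/-- Suppose that `d i H` is linearly equivalent to the reduced divisor of `parts i`, that every
lattice point of its polytope is a sum of `d i` lattice points of the polytope of `H`, and that the
order along each `D_j` is attained. Then restricting generic forms of degrees `d i` amounts to
choosing generic Laurent polynomials with the polytopes of the `parts i`. -/
lemma genericHypersurfaceIntersection_eq_genericCompactified
    (h0 : (0 : ι → ℝ) ∈ interior (hullOf e)) {H : I → ℤ} {r : ℕ} {d : Fin r → ℕ}
    {parts : Fin r → Set I} {μ : Fin r → ι → ℤ}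
    (hμ : ∀ i j, d i * H j - divisorOf (parts i) j = μ i ⬝ᵥ e j)
    (hfinH : (sectionExponents e H).Finite)
    (hfin : ∀ i, (sectionExponents e (divisorOf (parts i))).Finite)
    (hsurj : ∀ i, ∀ m ∈ sectionExponents e (divisorOf (parts i)),
      ∃ α : DegreeMonomial e H (d i), μ i + restrictExponent α.1 = m)
    (hexact : ∀ i j, ∃ m ∈ sectionExponents e (divisorOf (parts i)),
      m ⬝ᵥ e j = -divisorOf (parts i) j) :
    genericHypersurfaceIntersection e H d =
      genericCompactified (hullOf e) (fun i => sectionPolytope e (parts i)) := by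
  classical
  have hfin' : ∀ i, Finite (latticePoints (sectionPolytope e (parts i))) := fun i =>
    ((hfin i).subset fun m hm => mem_latticePoints_sectionPolytope.1 hm).to_subtype
  have := fun i => Fintype.ofFinite (latticePoints (sectionPolytope e (parts i)))
  have := fun i => finite_degreeMonomial hfinH (d i)
  have := fun i => Fintype.ofFinite (DegreeMonomial e H (d i))
  have hmem : ∀ i (α : DegreeMonomial e H (d i)),
      μ i + restrictExponent α.1 ∈ latticePoints (sectionPolytope e (parts i)) := by
    intro i α
    rw [mem_latticePoints_sectionPolytope]
    intro j
    have := le_restrictExponent_dotProduct α j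
    rw [add_dotProduct, ← hμ]
    linarith
  set π : (Σ i, DegreeMonomial e H (d i)) → Σ i, latticePoints (sectionPolytope e (parts i)) :=
    fun s => ⟨s.1, ⟨_, hmem s.1 s.2⟩⟩ with hπdef
  have hπ : Function.Surjective π := by
    rintro ⟨i, m, hm⟩
    obtain ⟨α, rfl⟩ := hsurj i m (mem_latticePoints_sectionPolytope.1 hm)
    exact ⟨⟨i, α⟩, rfl⟩
  have hlaurent : ∀ (c : (Σ i, DegreeMonomial e H (d i)) → ℂ) i,
      laurentOf (sectionPolytope e (parts i))
        (fun m => ∑ᶠ s : {s // π s = ⟨i, m⟩}, c s) =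
      character (μ i) * restrictForm e H (formOf e H (d i) fun α => c ⟨i, α⟩) := by
    intro c i
    have hform : character (μ i) * restrictForm e H (formOf e H (d i) fun α => c ⟨i, α⟩) =
        ∑ α : DegreeMonomial e H (d i),
          AddMonoidAlgebra.single (μ i + restrictExponent α.1) (c ⟨i, α⟩) := by
      rw [formOf, finsum_eq_sum_of_fintype]
      have : ∀ p : DegreeMonomial e H (d i) → MvPolynomial (sectionExponents e H) ℂ,
          restrictForm e H (∑ α, p α) = ∑ α, restrictForm e H (p α) := fun p => by
        simp only [restrictForm, map_sum]
      rw [this, Finset.mul_sum]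
      refine Finset.sum_congr rfl fun α _ => ?_
      rw [restrictForm_monomial, character, AddMonoidAlgebra.single_mul_single, one_mul]
    rw [hform, laurentOf, finsum_eq_sum_of_fintype]
    have hinner : ∀ m : latticePoints (sectionPolytope e (parts i)),
        ∑ᶠ s : {s // π s = ⟨i, m⟩}, c s =
          ∑ α : DegreeMonomial e H (d i),
            if μ i + restrictExponent α.1 = m then c ⟨i, α⟩ else 0 := by
      intro m
      rw [finsum_fiber_eq_sum, Fintype.sum_sigma, Finset.sum_eq_single i]
      · refine Finset.sum_congr rfl fun α _ => ?_
        have : π ⟨i, α⟩ = ⟨i, m⟩ ↔ μ i + restrictExponent α.1 = m := by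
          simp [hπdef, Subtype.ext_iff]
        simp only [this]
      · intro i' _ hne
        refine Finset.sum_eq_zero fun α _ => if_neg fun h => hne ?_
        exact congrArg Sigma.fst h
      · simp
    have hsum : ∀ m : latticePoints (sectionPolytope e (parts i)),
        (AddMonoidAlgebra.single (m : ι → ℤ) (∑ᶠ s : {s // π s = ⟨i, m⟩}, c s) : Laurent ι) =
        ∑ α : DegreeMonomial e H (d i),
          if μ i + restrictExponent α.1 = m then
            AddMonoidAlgebra.single (μ i + restrictExponent α.1) (c ⟨i, α⟩) else 0 := by
      intro m
      rw [hinner]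
      change AddMonoidAlgebra.singleAddHom (m : ι → ℤ) _ = _
      rw [map_sum]
      refine Finset.sum_congr rfl fun α _ => ?_
      split_ifs with h
      · rw [h]; rfl
      · rw [map_zero]
    simp only [hsum]
    rw [Finset.sum_comm]
    refine Finset.sum_congr rfl fun α _ => ?_
    rw [Finset.sum_eq_single ⟨_, hmem i α⟩]
    · simp
    · intro m _ hne
      exact if_neg fun h => hne (Subtype.ext h.symm)
    · simp
  refine congrArg (GenericSubscheme.mk (hullOf e)) ?_
  rw [← map_fiberSum_genericFilter hπ, Filter.map_map]
  refine Filter.map_congr ?_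
  have hne := eventually_genericFilter_ne_zero
    (Σ i, latticePoints (sectionPolytope e (parts i)))
  rw [← map_fiberSum_genericFilter hπ, Filter.eventually_map] at hne
  filter_upwards [hne] with c hc
  refine hypersurfaceIntersection_eq_compactified h0 hμ (fun i => hlaurent c i) (fun i => ?_)
    fun i j => ?_
  · rw [mem_globalSections]
    intro m hm
    by_cases hmQ : m ∈ latticePoints (sectionPolytope e (parts i))
    · exact mem_latticePoints_sectionPolytope.1 hmQ
    · exact absurd (coeff_laurentOf_of_notMem _ hmQ) hm
  · obtain ⟨m, hm, hmj⟩ := hexact i j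
    refine ⟨m, ?_, hmj⟩
    have hmQ := mem_latticePoints_sectionPolytope.2 hm
    rw [coeff_laurentOf _ ⟨m, hmQ⟩]
    exact hc ⟨i, ⟨m, hmQ⟩⟩

end HypersurfaceSections

/-! ### Generic complete intersections in `P(k,n)` -/

section CompleteIntersections

variable {k n : ℕ} (hk : 1 ≤ k) (hkn : k < n)
include hk hkn

lemma finite_sectionExponents_gVec (a : GVertex k n → ℤ) :
    (sectionExponents (gVec k n) a).Finite := by
  obtain ⟨C, hC⟩ := exists_bound_of_le_dotProduct_gVec hk hkn a
  refine finite_of_abs_le (C := C) fun m hm p => hC (latticeVec m) (fun ρ => ?_) p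
  rw [latticeVec_dotProduct]
  exact_mod_cast hm ρ

/-- A multiple of `D(E_l)` with a non-zero section is a non-negative multiple. -/
lemma nonneg_of_le_dotProduct_gVec {l : ℕ} (hl : l ∈ Finset.Icc 1 n) {c : ℤ}
    {m : Fin k × Fin (n - k) → ℤ}
    (h : ∀ ρ, -(c * divisorOf (gE k n l) ρ) ≤ m ⬝ᵥ gVec k n ρ) : 0 ≤ c := by
  have hA : ({l} : Finset ℕ) ⊆ Finset.Icc 1 n := Finset.singleton_subset_iff.2 hl
  have hφ := isFlowOrder_gridExt_add hk hkn (c := (c : ℝ)) (y := latticeVec m)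
    (κ := fun q => ((c * cutSum k {l} q : ℤ) : ℝ)) (by simp [cutSum_source])
    (by simp [cutSum_sink hkn hA]) fun ρ => by
      have := h ρ
      rw [← gMerged_singleton, ← cutSum_sub hk hkn hA] at this
      rw [latticeVec_dotProduct, ← Int.cast_sub, ← mul_sub]
      exact_mod_cast this
  exact_mod_cast hφ.nonneg hk hkn

/-- The Picard group is torsion free and `-D(E_l)` is not ample, so every ample generator is
linearly equivalent to `D(E_l)`. -/
lemma IsAmpleGenerator.linEquivalent {H : GVertex k n → ℤ} (hH : IsAmpleGenerator (gVec k n) H)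
    {l : ℕ} (hl : l ∈ Finset.Icc 1 n) :
    LinEquivalent (gVec k n) H (divisorOf (gE k n l)) := by
  have hD := isAmpleGenerator_divisorOf_gE hk hkn hl
  obtain ⟨c, h, hc⟩ := hD.2.2 H hH.1
  obtain ⟨c', h', hc'⟩ := hH.2.2 _ hD.1
  simp only [Pi.smul_apply, smul_eq_mul] at hc hc'
  have hmul : c' * c = 1 := by
    have h1 : 0 ≤ c' * c - 1 := nonneg_of_le_dotProduct_gVec hk hkn hl (m := h' + c' • h)
      fun ρ => by
        rw [add_dotProduct, smul_dotProduct, ← hc, ← hc', smul_eq_mul]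
        linarith
    have h2 : 0 ≤ 1 - c' * c := nonneg_of_le_dotProduct_gVec hk hkn hl (m := -(h' + c' • h))
      fun ρ => by
        rw [neg_dotProduct, add_dotProduct, smul_dotProduct, ← hc, ← hc', smul_eq_mul]
        linarith
    linarith
  -- on the chart of the empty face, the torus, ampleness gives a non-zero section
  obtain ⟨q, hq, s, hs, hsgen, -⟩ :=
    hH.2.1 ∅ (isProperFace_empty (zero_mem_interior_hullOf_gVec hk hkn))
  have hs0 : s ≠ 0 := by
    rintro rfl
    obtain ⟨f, -, hf⟩ := (hsgen (character 0)).1 (character_mem_localSections.2 (by simp))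
    rw [zero_mul] at hf
    have := coeff_character_ne_zero.2 (rfl : (0 : Fin k × Fin (n - k) → ℤ) = 0)
    rw [hf] at this
    exact this rfl
  obtain ⟨m, hm⟩ : ∃ m, s.coeff m ≠ 0 := by
    by_contra hcon
    push Not at hcon
    exact hs0 (AddMonoidAlgebra.ext (Finsupp.ext hcon))
  have hqc : 0 ≤ q * c := nonneg_of_le_dotProduct_gVec hk hkn hl (m := m + (q : ℤ) • h) fun ρ => by
    have h1 : -(q • H ρ) ≤ m ⬝ᵥ gVec k n ρ := mem_globalSections.1 hs m hm ρ
    rw [nsmul_eq_mul] at h1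
    rw [add_dotProduct, smul_dotProduct, ← hc, smul_eq_mul]
    linarith
  have hc0 : 0 ≤ c := nonneg_of_mul_nonneg_right hqc (by exact_mod_cast hq)
  have hc1 : c = 1 := by
    rcases Int.eq_one_or_neg_one_of_mul_eq_one (by rwa [mul_comm] at hmul : c * c' = 1) with h | h
    · exact h
    · omega
  exact ⟨h, fun ρ => by rw [← hc, hc1, one_mul]⟩

omit hk hkn in
/-- An integral increasing function on the network with value `d` at the sink is the sum of the `d`
indicator functions of its superlevel sets. -/
lemma IsFlowOrder.exists_sum_orderPoints {d : ℕ} {ζ : ℕ × ℕ → ℤ}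
    (hζ : IsFlowOrder k n (d : ℤ) ζ) :
    ∃ χ : Fin d → Fin k × Fin (n - k) → ℤ, (∀ t, χ t ∈ orderPoints k n) ∧
      ∑ t, χ t = gridRes k n ζ := by
  refine ⟨fun t => gridRes k n fun q => if (t : ℤ) < ζ q then 1 else 0, fun t => ⟨_, ⟨?_, ?_, ?_⟩,
    rfl⟩, ?_⟩
  · rw [hζ.source, if_neg (by omega)]
  · rw [hζ.sink, if_pos (by exact_mod_cast t.2)]
  · intro ρ
    have := hζ.mono ρ
    split_ifs <;> omega
  · funext p
    have hb := hζ.gridRes_bounds p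
    rw [Finset.sum_apply]
    simp only [gridRes]
    generalize ζ ((p.1 : ℕ) + 1, (p.2 : ℕ) + 1) = z at hb
    lift z to ℕ using hb.1
    have hz : z ≤ d := by exact_mod_cast hb.2
    rw [Finset.sum_boole]
    have h1 : (Finset.univ.filter fun t : Fin d => ((t : ℕ) : ℤ) < (z : ℤ)) =
        Finset.univ.filter fun t : Fin d => (t : ℕ) < z := by simp
    rw [h1, Fin.card_filter_val_lt]
    simp [hz]

/-- Let the class of `H` be the ample generator. Then generic hypersurfaces of degrees `|J i|` in
the embedding by `|H|` cut out the closures of generic Laurent hypersurfaces with the polytopes of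
the merged groups. -/
lemma genericHypersurfaceIntersection_gVec {H : GVertex k n → ℤ}
    (hH : IsAmpleGenerator (gVec k n) H) {r : ℕ} {d : Fin r → ℕ} {J : Fin r → Finset ℕ}
    (hcard : ∀ i, (J i).card = d i) (hJ : ∀ i, J i ⊆ Finset.Icc 1 n) :
    genericHypersurfaceIntersection (gVec k n) H d =
      genericCompactified (hullOf (gVec k n))
        (fun i => sectionPolytope (gVec k n) (gMerged k n (J i))) := by
  have h1 : 1 ∈ Finset.Icc 1 n := Finset.mem_Icc.2 ⟨le_rfl, by omega⟩
  have hA : ({1} : Finset ℕ) ⊆ Finset.Icc 1 n := Finset.singleton_subset_iff.2 h1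
  obtain ⟨h, hh⟩ := hH.linEquivalent hk hkn h1
  set μ : Fin r → Fin k × Fin (n - k) → ℤ := fun i =>
    (d i : ℤ) • h + gridRes k n (fun q => d i * cutSum k {1} q - cutSum k (J i) q) with hμ
  refine genericHypersurfaceIntersection_eq_genericCompactified
    (zero_mem_interior_hullOf_gVec hk hkn) (μ := μ) (fun i ρ => ?_)
    (finite_sectionExponents_gVec hk hkn _) (fun i => finite_sectionExponents_gVec hk hkn _)
    (fun i m hm => ?_) (fun i ρ => ?_)
  · rw [hμ, add_dotProduct, smul_dotProduct, ← hh, gridRes_dotProduct_gVec_int hk hkn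
      (by simp [cutSum_source]) (by simp [cutSum_sink hkn hA, cutSum_sink hkn (hJ i), hcard]),
      ← gMerged_singleton, ← cutSum_sub hk hkn hA, ← cutSum_sub hk hkn (hJ i), smul_eq_mul]
    ring
  · have hζ : IsFlowOrder k n (d i : ℤ) (fun q => gridExt 0 m q + cutSum k (J i) q) := by
      refine ⟨by simp [gridExt_source, cutSum_source],
        by simp [gridExt_sink, cutSum_sink hkn (hJ i), hcard], fun ρ => ?_⟩
      have h2 := hm ρ
      rw [← cutSum_sub hk hkn (hJ i)] at h2
      have h3 := dotProduct_gVec hk hkn m ρ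
      simp only [Int.cast_id] at h3
      change m ⬝ᵥ gVec k n ρ = _ at h3
      linarith
    obtain ⟨χ, hχ, hsum⟩ := hζ.exists_sum_orderPoints
    have hx : ∀ t, χ t - gridRes k n (cutSum k {1}) - h ∈ sectionExponents (gVec k n) H := by
      intro t ρ
      have h2 := card_smul_sub_cutSum_mem hk hkn hA (hχ t) ρ
      rw [Finset.card_singleton, Nat.cast_one, one_smul, gMerged_singleton] at h2
      rw [sub_dotProduct, ← hh]
      linarith
    refine ⟨⟨∑ t, Finsupp.single ⟨_, hx t⟩ 1, ?_⟩, ?_⟩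
    · rw [map_sum]
      simp
    · have h2 : restrictExponent (∑ t, Finsupp.single
          (⟨_, hx t⟩ : sectionExponents (gVec k n) H) 1) =
          ∑ t, (χ t - gridRes k n (cutSum k {1}) - h) := by
        rw [restrictExponent, ← Finsupp.sum_finsetSum_index (by simp)
          (by intros; rw [add_smul])]
        simp
      rw [h2, Finset.sum_sub_distrib, Finset.sum_sub_distrib, hsum]
      funext p
      have h3 := congrFun (gridRes_gridExt 0 m) p
      simp only [gridRes] at h3
      simp [hμ, gridRes, h3]
      ring
  · -- the up-set behind the first or the last cut, whichever the edge does not cross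
    obtain ⟨l, hl, hρ⟩ : ∃ l ∈ Finset.Icc 1 n, gGroup k n ρ ≠ l := by
      by_cases hρ : gGroup k n ρ = 1
      · exact ⟨n, Finset.mem_Icc.2 ⟨by omega, le_rfl⟩, by omega⟩
      · exact ⟨1, h1, hρ⟩
    have hψ := isFlowOrder_gridCut hk hkn hl
    refine ⟨_, card_smul_sub_cutSum_mem hk hkn (hJ i) ⟨_, hψ, rfl⟩, ?_⟩
    rw [card_smul_sub_cutSum_dotProduct hk hkn (hJ i) hψ, gridCut_sub hk hkn hl, if_neg hρ]
    ring

end CompleteIntersections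

theorem mainTheorem8 (k n : ℕ) (hk : 1 ≤ k) (hkn : k < n) (r : ℕ) (d : Fin r → ℕ)
    (hd : ∀ i, 1 ≤ d i) (hsum : ∑ i, d i = n)
    (J : Fin r → Finset ℕ) (hcard : ∀ i, (J i).card = d i)
    (hdisj : Pairwise fun i i' => Disjoint (J i) (J i'))
    (hunion : (Finset.univ.biUnion J) = Finset.Icc 1 n) :
    -- the merged groups form a nef-partition
    IsNefPartition (gVec k n) (fun i => gMerged k n (J i)) ∧
    -- the divisors of the groups are ample generators of the Picard group
    (∀ l ∈ Finset.Icc 1 n, IsAmpleGenerator (gVec k n) (divisorOf (gE k n l))) ∧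
    -- the mirror of the generic complete intersection of degrees `d i`
    (∀ H : GVertex k n → ℤ, IsAmpleGenerator (gVec k n) H →
      IsBatyrevBorisovMirror (gVec k n) (fun i => gMerged k n (J i))
        (genericHypersurfaceIntersection (gVec k n) H d)
        (genericCompactified
          (polarDual (minkowskiSum fun i => nablaOf (gVec k n) (gMerged k n (J i))))
          (fun i => nablaOf (gVec k n) (gMerged k n (J i))))) ∧
    -- the ambient variety of the mirror is Gorenstein Fano and its anticanonical
    -- polytope is the sum of the Newton polytopes
    IsReflexive (minkowskiSum fun i => nablaOf (gVec k n) (gMerged k n (J i))) := by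
  have hnef := isNefPartition_gMerged hk hkn hdisj hunion
  have hJ : ∀ i, J i ⊆ Finset.Icc 1 n := fun i =>
    hunion ▸ Finset.subset_biUnion_of_mem J (Finset.mem_univ i)
  exact ⟨hnef, fun l hl => isAmpleGenerator_divisorOf_gE hk hkn hl,
    fun H hH => ⟨hnef, genericHypersurfaceIntersection_gVec hk hkn hH hcard hJ, rfl⟩,
    isReflexive_minkowskiSum_nablaOf hk hkn hdisj hunion⟩
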